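/- Let $X$ be an arbitrary set. A concept (or hypothesis) is a function $X\to\{0,1\}$, and a concept class is a set $C$ of concepts. All distributions are discrete (probability mass functions), so that every event has a probability; an algorithm maps each input to a distribution on outputs. $\mathrm{VC}(C)\in\{0,1,2,\dots\}\cup\{\infty\}$ is the supremum of the sizes of the finite subsets of $X$ shattered by $C$. For $m\le n$, an $(\alpha,\beta,\varepsilon,\delta,n,m)$-PSSL (private semi-supervised learner) for $C$ is a randomized algorithm $A$ that takes a database in $(X\times\{0,1,\bot\})^n$ and outputs a hypothesis, such that 1. (learning) for every $c\in C$ and every distribution $\mu$ on $X$: if $D=(x_i,y_i)_{i=1}^n$ with $x_1,\dots,x_n$ drawn i.i.d. from $\mu$, $y_i=c(x_i)$ for $i\le m$ and $y_i=\bot$ for $i>m$, then $\Pr[A(D)=h \text{ with } \Pr_{x\sim\mu}[h(x)\ne c(x)]>\alpha]\le\beta$, the probability being over the sample and the coins of $A$; 2. (privacy) $A$ is $(\varepsilon,\delta)$-differentially private: for any two databases $D_1,D_2\in(X\times\{0,1,\bot\})^n$ that differ in exactly one entry and every set $F$ of hypotheses, $\Pr[A(D_1)\in F]\le e^{\varepsilon}\Pr[A(D_2)\in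 F]+\delta$. **Theorem.** There are absolute constants $\lambda,K>0$ such that for every set $X$, every concept class $C$ over $X$, all $\alpha,\beta\in(0,1)$, $\varepsilon\in(0,1]$, $\delta\ge 0$ and every integer $n\ge 0$: if there exists an $(\alpha,\beta,1,\delta,n,n)$-PSSL for $C$, then there exist integers $n',m\ge 0$ with $$n'\le K\,\frac{n}{\varepsilon},\qquad m\le K\,\frac{\mathrm{VC}(C)\,\log\frac{1}{\alpha\beta}}{\alpha\,\varepsilon}$$ (the second condition being void if $\mathrm{VC}(C)=\infty$) and a $(\lambda\alpha,\lambda\beta,\varepsilon,\delta,n',m)$-PSSL for $C$. -/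

import Mathlib

open scoped ENNReal

namespace PrivateLearning

noncomputable section

/-- The probability of the event `E` under the (discrete) distribution `p`. -/
def prob {Ω : Type*} (p : PMF Ω) (E : Set Ω) : ℝ := (p.toOuterMeasure E).toReal

/-- The distribution of `n` i.i.d. samples from `μ`: one sample from `μ`, followed by `n - 1`
further samples drawn independently of it. -/
def iid {X : Type*} (μ : PMF X) : (n : ℕ) → PMF (Fin n → X)
  | 0 => PMF.pure Fin.elim0
  | n + 1 => μ.bind fun x => (iid μ n).bind fun xs => PMF.pure (Fin.cons x xs)

/-- The law of `n` i.i.d. samples is the product law. -/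
theorem iid_apply {X : Type*} (μ : PMF X) : ∀ (n : ℕ) (xs : Fin n → X),
    iid μ n xs = ∏ i, μ (xs i)
  | 0, xs => by
    simp [iid, PMF.pure_apply, Subsingleton.elim xs Fin.elim0]
  | n + 1, xs => by
    classical
    rw [iid, PMF.bind_apply, tsum_eq_single (xs 0), PMF.bind_apply, tsum_eq_single (Fin.tail xs),
      PMF.pure_apply, if_pos (Fin.cons_self_tail xs).symm, mul_one, iid_apply μ n,
      Fin.prod_univ_succ]
    · rfl
    · intro ys hys
      rw [PMF.pure_apply, if_neg, mul_zero]
      intro h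
      exact hys (by rw [h, Fin.tail_cons])
    · intro x hx
      rw [PMF.bind_apply, ENNReal.tsum_eq_zero.2, mul_zero]
      intro ys
      rw [PMF.pure_apply, if_neg, mul_zero]
      intro h
      exact hx (by rw [h, Fin.cons_zero])

/-- Concepts and hypotheses over `X` are functions `X → Bool`; a concept class over `X` is a
set of concepts. -/
abbrev Concept (X : Type*) : Type _ := X → Bool

/-- A partially labeled database with `n` entries in `X × {0, 1, ⊥}`; `none` is the missing
label `⊥`. -/
abbrev Database (X : Type*) (n : ℕ) : Type _ := Fin n → X × Option Bool

/-- A randomized algorithm that takes a partially labeled database of size `n` and outputs a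
hypothesis. -/
abbrev Algorithm (X : Type*) (n : ℕ) : Type _ := Database X n → PMF (Concept X)

/-- Two databases of the same size are neighboring if they differ in exactly one entry. -/
def Neighboring {X : Type*} {n : ℕ} (D₁ D₂ : Database X n) : Prop :=
  ∃! i, D₁ i ≠ D₂ i

/-- `(ε, δ)`-differential privacy. -/
def IsDifferentiallyPrivate {X : Type*} {n : ℕ} (ε δ : ℝ) (A : Algorithm X n) : Prop :=
  ∀ D₁ D₂ : Database X n, Neighboring D₁ D₂ → ∀ F : Set (Concept X),
    prob (A D₁) F ≤ Real.exp ε * prob (A D₂) F + δ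

/-- The generalization error `Pr_{x ∼ μ}[h x ≠ c x]`. -/
def genError {X : Type*} (μ : PMF X) (c h : Concept X) : ℝ :=
  prob μ {x | h x ≠ c x}

/-- The database on the points `xs` in which the first `m` entries are labeled by `c` and the
other entries are unlabeled. -/
def labelFirst {X : Type*} {n : ℕ} (c : Concept X) (m : ℕ) (xs : Fin n → X) : Database X n :=
  fun i => (xs i, if (i : ℕ) < m then some (c (xs i)) else none)

/-- The output distribution of `A` on `n` i.i.d. samples from `μ`, the first `m` of which are
labeled by `c`; the samples and the coins of `A` are both random. -/
def outputDist {X : Type*} {n : ℕ} (A : Algorithm X n) (m : ℕ) (c : Concept X) (μ : PMF X) :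
    PMF (Concept X) :=
  (iid μ n).bind fun xs => A (labelFirst c m xs)

/-- `A` is an `(α, β, n, m)`-semi-supervised learner for `C`: `n` examples, the first `m ≤ n`
of them labeled. -/
def IsSSL {X : Type*} {n : ℕ} (C : Set (Concept X)) (α β : ℝ) (m : ℕ) (A : Algorithm X n) :
    Prop :=
  m ≤ n ∧ ∀ c ∈ C, ∀ μ : PMF X, prob (outputDist A m c μ) {h | α < genError μ c h} ≤ β

/-- `A` is an `(α, β, ε, δ, n, m)`-private semi-supervised learner for `C`. -/
def IsPSSL {X : Type*} (C : Set (Concept X)) (α β ε δ : ℝ) (n m : ℕ) (A : Algorithm X n) :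
    Prop :=
  IsSSL C α β m A ∧ IsDifferentiallyPrivate ε δ A

/-- The finite set `B` is shattered by `C`: every dichotomy of `B` is realized by `C`. -/
def IsShattered {X : Type*} (C : Set (Concept X)) (B : Finset X) : Prop :=
  ∀ f : Concept X, ∃ c ∈ C, ∀ x ∈ B, c x = f x

/-- The VC dimension: the supremum of the sizes of the finite sets shattered by `C`, which is
`⊤` if arbitrarily large finite sets are shattered. -/
def vcDim {X : Type*} (C : Set (Concept X)) : ℕ∞ :=
  ⨆ (B : Finset X) (_ : IsShattered C B), (B.card : ℕ∞)

end

end PrivateLearning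

namespace PrivateLearning

noncomputable section

/-! Expectations with respect to discrete distributions -/

/-! Labels are needed only to locate a concept close to the target; the learner can then label most
of its sample itself. Given `s` labeled examples, the exponential mechanism labels `2 * s` fresh
points by some `h'` in `C` that nearly agrees with the target on the examples, and a learner for `2
* s` labeled examples is run on the result. Starting from a learner with at least `2 * n` labeled
examples and iterating, the labeled sample shrinks to order VC(C) log(1/(αβ))/α, while the total
stays O(n).

Three observations keep the iteration from accumulating losses. Privacy (`RobustlyLearnable.boost`):
the labeled examples of the new learner enter only the exponential mechanism, which costs a factor 4
(`ev_relabel_examples_le`). A fresh point costs 4 times what the old learner charges for a labeled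
example (`ev_relabel_points_le`), and the other unlabeled points cost what they did before. So the
pair of bounds `a` (labeled) and `4 * a` (unlabeled) is invariant once `4 ≤ a`. Accuracy
(`chain_bound`): stage `j` has `2 ^ j * s` examples and may add error α(3/4)^j and failure
β/2^(j+1). Both are summable, and error times sample size grows like (3/2)^j, which beats the growth
of log(1/error). Adaptivity: `h'` depends on the fresh points, so the next learner must tolerate a
target chosen after its sample. `RobustlyLearnable` therefore has its supremum over targets inside
the expectation.

The first robust learner (`RobustlyLearnable.of_isPSSL`) runs the given one on `n` draws from `N`
examples, that is, on their empirical distribution. Its output may lie outside `C`, so the output's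
true error is controlled on the points that were not drawn. All generalization bounds come from
`uniform_convergence` with Sauer–Shelah. At the end, choosing each entry among about 32/ε candidates
(`stable_amplify`) turns the constant privacy factor 32 into e^ε. -/

/-- The expectation of a nonnegative function. -/
def ev {Ω : Type*} (p : PMF Ω) (f : Ω → ℝ≥0∞) : ℝ≥0∞ := ∑' a, p a * f a

section ev

variable {Ω Ω' : Type*} (p : PMF Ω)

theorem ev_mono {f g : Ω → ℝ≥0∞} (h : ∀ a, f a ≤ g a) : ev p f ≤ ev p g :=
  ENNReal.tsum_le_tsum fun a => mul_le_mul_right (h a) _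

theorem ev_const (c : ℝ≥0∞) : ev p (fun _ => c) = c := by
  rw [ev, ENNReal.tsum_mul_right, p.tsum_coe, one_mul]

theorem ev_le {f : Ω → ℝ≥0∞} {c : ℝ≥0∞} (h : ∀ a, f a ≤ c) : ev p f ≤ c :=
  (ev_mono p h).trans_eq (ev_const p c)

theorem le_ev {f : Ω → ℝ≥0∞} {c : ℝ≥0∞} (h : ∀ a, c ≤ f a) : c ≤ ev p f :=
  (ev_const p c).symm.trans_le (ev_mono p h)

theorem ev_add (f g : Ω → ℝ≥0∞) : ev p (fun a => f a + g a) = ev p f + ev p g := by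
  simp only [ev, mul_add, ENNReal.tsum_add]

theorem ev_mul_left (c : ℝ≥0∞) (f : Ω → ℝ≥0∞) : ev p (fun a => c * f a) = c * ev p f := by
  simp only [ev, ← ENNReal.tsum_mul_left]
  exact tsum_congr fun a => by ring

theorem ev_mul_right (c : ℝ≥0∞) (f : Ω → ℝ≥0∞) : ev p (fun a => f a * c) = ev p f * c := by
  simp only [mul_comm _ c, ev_mul_left]

theorem ev_finsetSum {ι : Type*} (s : Finset ι) (f : ι → Ω → ℝ≥0∞) :
    ev p (fun a => ∑ i ∈ s, f i a) = ∑ i ∈ s, ev p (f i) := by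
  simp only [ev, Finset.mul_sum]
  exact Summable.tsum_finsetSum fun _ _ => ENNReal.summable

theorem ev_pure (a : Ω) (f : Ω → ℝ≥0∞) : ev (PMF.pure a) f = f a := by
  rw [ev, tsum_eq_single a]
  · simp
  · intro b hb
    simp [PMF.pure_apply, hb]

theorem ev_bind (q : Ω → PMF Ω') (f : Ω' → ℝ≥0∞) :
    ev (p.bind q) f = ev p (fun a => ev (q a) f) := by
  simp only [ev, PMF.bind_apply, ← ENNReal.tsum_mul_right, ← ENNReal.tsum_mul_left]
  rw [ENNReal.tsum_comm]
  simp only [mul_assoc]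

theorem ev_map (g : Ω → Ω') (f : Ω' → ℝ≥0∞) : ev (p.map g) f = ev p (fun a => f (g a)) := by
  rw [PMF.map, ev_bind]
  simp only [Function.comp, ev_pure]

theorem ev_comm (q : PMF Ω') (f : Ω → Ω' → ℝ≥0∞) :
    ev p (fun a => ev q (f a)) = ev q (fun b => ev p (fun a => f a b)) := by
  simp only [ev, ← ENNReal.tsum_mul_left]
  rw [ENNReal.tsum_comm]
  exact tsum_congr fun b => tsum_congr fun a => by ring

theorem ev_fintype [Fintype Ω] (f : Ω → ℝ≥0∞) : ev p f = ∑ a, p a * f a :=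
  tsum_fintype _

/-- The probability of an event, as an extended nonnegative real. -/
abbrev pr {Ω : Type*} (p : PMF Ω) (F : Set Ω) : ℝ≥0∞ := p.toOuterMeasure F

theorem pr_eq_ev (F : Set Ω) : pr p F = ev p (F.indicator 1) := by
  rw [pr, PMF.toOuterMeasure_apply, ev]
  refine tsum_congr fun a => ?_
  by_cases h : a ∈ F <;> simp [h]

theorem pr_mono {F G : Set Ω} (h : F ⊆ G) : pr p F ≤ pr p G :=
  p.toOuterMeasure.mono h

theorem pr_union (F G : Set Ω) : pr p (F ∪ G) ≤ pr p F + pr p G :=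
  MeasureTheory.measure_union_le F G

theorem pr_le_one (F : Set Ω) : pr p F ≤ 1 := by
  rw [pr_eq_ev]
  exact ev_le p fun a => Set.indicator_le_self' (fun _ _ => zero_le) a

theorem pr_ne_top (F : Set Ω) : pr p F ≠ ∞ :=
  ((pr_le_one p F).trans_lt ENNReal.one_lt_top).ne

theorem pr_bind (q : Ω → PMF Ω') (F : Set Ω') :
    pr (p.bind q) F = ev p (fun a => pr (q a) F) :=
  PMF.toOuterMeasure_bind_apply p q F

theorem ev_uniform [Fintype Ω] [Nonempty Ω] (f : Ω → ℝ≥0∞) :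
    ev (PMF.uniformOfFintype Ω) f = (∑ a, f a) / Fintype.card Ω := by
  rw [ev_fintype, ENNReal.div_eq_inv_mul, Finset.mul_sum]
  simp

end ev

/-! Product distributions -/

theorem tsum_finPi_prod {X : Type*} : ∀ (n : ℕ) (f : Fin n → X → ℝ≥0∞),
    ∑' x : Fin n → X, ∏ i, f i (x i) = ∏ i, ∑' a, f i a
  | 0, f => by simp
  | n + 1, f => by
    rw [← (Fin.consEquiv fun _ => X).tsum_eq, ENNReal.tsum_prod', Fin.prod_univ_succ,
      ← tsum_finPi_prod n, ← ENNReal.tsum_mul_right]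
    refine tsum_congr fun a => ?_
    rw [← ENNReal.tsum_mul_left]
    refine tsum_congr fun x => ?_
    simp [Fin.consEquiv, Fin.prod_univ_succ]

theorem tsum_pi_prod {ι X : Type*} [Fintype ι] (f : ι → X → ℝ≥0∞) :
    ∑' x : ι → X, ∏ i, f i (x i) = ∏ i, ∑' a, f i a := by
  let e := Fintype.equivFin ι
  rw [← (e.symm.arrowCongr (Equiv.refl X)).tsum_eq, ← e.symm.prod_comp, ← tsum_finPi_prod]
  refine tsum_congr fun x => ?_
  rw [← e.symm.prod_comp]
  simp [Equiv.arrowCongr]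

/-- The product distribution indexed by a finite type. -/
def iidOn {X : Type*} (ι : Type*) [Fintype ι] (μ : PMF X) : PMF (ι → X) :=
  ⟨fun x => ∏ i, μ (x i), by
    rw [ENNReal.summable.hasSum_iff, tsum_pi_prod]
    simp⟩

theorem iidOn_apply {X ι : Type*} [Fintype ι] (μ : PMF X) (x : ι → X) :
    iidOn ι μ x = ∏ i, μ (x i) := rfl

theorem iid_eq_iidOn {X : Type*} (μ : PMF X) (n : ℕ) : iid μ n = iidOn (Fin n) μ :=
  PMF.ext fun x => by rw [iid_apply, iidOn_apply]

section iidOn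

variable {X : Type*} {ι κ : Type*} [Fintype ι] [Fintype κ] (μ : PMF X)

theorem ev_iidOn_prod (g : ι → X → ℝ≥0∞) :
    ev (iidOn ι μ) (fun x => ∏ i, g i (x i)) = ∏ i, ev μ (g i) := by
  simp only [ev, iidOn_apply, ← Finset.prod_mul_distrib]
  exact tsum_pi_prod fun i a => μ a * g i a

theorem ev_iidOn_equiv (e : ι ≃ κ) (f : (ι → X) → ℝ≥0∞) :
    ev (iidOn ι μ) f = ev (iidOn κ μ) (fun y => f (y ∘ e)) := by
  rw [ev, ev, ← (e.symm.arrowCongr (Equiv.refl X)).tsum_eq]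
  refine tsum_congr fun y => ?_
  rw [iidOn_apply, iidOn_apply, ← e.prod_comp]
  rfl

theorem ev_iidOn_sum (f : (ι ⊕ κ → X) → ℝ≥0∞) :
    ev (iidOn (ι ⊕ κ) μ) f =
      ev (iidOn ι μ) (fun x => ev (iidOn κ μ) (fun y => f (Sum.elim x y))) := by
  rw [ev, ← (Equiv.sumArrowEquivProdArrow ι κ X).symm.tsum_eq, ENNReal.tsum_prod', ev]
  refine tsum_congr fun x => ?_
  rw [ev, ← ENNReal.tsum_mul_left]
  refine tsum_congr fun y => ?_
  simp only [iidOn_apply, Fintype.prod_sum_type, Equiv.sumArrowEquivProdArrow, Equiv.coe_fn_symm_mk,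
    Sum.elim_inl, Sum.elim_inr, mul_assoc]

/-- Reading an i.i.d. sample at distinct positions gives an i.i.d. sample: the coordinates outside
the range integrate out. -/
theorem ev_iidOn_injective {φ : ι → κ} (hφ : φ.Injective) (f : (ι → X) → ℝ≥0∞) :
    ev (iidOn κ μ) (fun y => f (y ∘ φ)) = ev (iidOn ι μ) f := by
  classical
  rw [ev_iidOn_equiv μ (Equiv.sumCompl (· ∈ Set.range φ)).symm, ev_iidOn_sum,
    ev_iidOn_equiv μ (Equiv.ofInjective φ hφ)]
  refine tsum_congr fun x => ?_
  congr 1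
  refine Eq.trans ?_ (ev_const (iidOn {a // a ∉ Set.range φ} μ) _)
  refine congrArg _ (funext fun y => congrArg f (funext fun i => ?_))
  simp only [Function.comp_apply]
  rw [Equiv.sumCompl_symm_apply_of_pos ⟨i, rfl⟩]
  rfl

/-- Redrawing one coordinate independently does not change a product law. This isolates the
randomness of a single slot. -/
theorem ev_iidOn_update [DecidableEq ι] (i : ι) (f : (ι → X) → ℝ≥0∞) :
    ev (iidOn ι μ) f =
      ev (iidOn ι μ) (fun x => ev μ (fun a => f (Function.update x i a))) := by
  have key : ∀ g : (ι → X) → ℝ≥0∞, ev (iidOn ι μ) g =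
      ev μ (fun a => ev (iidOn {j // j ≠ i} μ)
        (fun y => g ((Equiv.funSplitAt i X).symm (a, y)))) := by
    intro g
    rw [ev, ← (Equiv.funSplitAt i X).symm.tsum_eq, ENNReal.tsum_prod', ev]
    refine tsum_congr fun a => ?_
    rw [ev, ← ENNReal.tsum_mul_left]
    refine tsum_congr fun y => ?_
    rw [iidOn_apply, iidOn_apply, Fintype.prod_eq_mul_prod_subtype_ne _ i, mul_assoc]
    congr 1
    · simp [Equiv.funSplitAt, Equiv.piSplitAt]
    · congr 1
      refine Finset.prod_congr rfl fun j _ => ?_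
      simp [Equiv.funSplitAt, Equiv.piSplitAt, j.2]
  rw [key, key]
  have : ∀ (a b : X) y, Function.update ((Equiv.funSplitAt i X).symm (a, y)) i b =
      (Equiv.funSplitAt i X).symm (b, y) := by
    intro a b y
    funext j
    by_cases h : j = i
    · subst h; simp [Equiv.funSplitAt, Equiv.piSplitAt]
    · simp [Equiv.funSplitAt, Equiv.piSplitAt, h]
  simp only [this]
  rw [ev_const, ev_comm]

end iidOn

theorem iid_map {X Y : Type*} (μ : PMF X) (f : X → Y) :
    ∀ n, iid (μ.map f) n = (iid μ n).map (fun x => f ∘ x)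
  | 0 => by
    simp only [iid, PMF.pure_map]
    congr 1
    exact Subsingleton.elim _ _
  | n + 1 => by
    simp only [iid, PMF.bind_map, PMF.map_bind, iid_map μ f n, PMF.pure_map, Function.comp_def]
    congr 1
    funext a
    congr 1
    funext x
    congr 1
    funext i
    refine Fin.cases ?_ (fun j => ?_) i <;> simp

/-! Traces of concept classes and the Sauer–Shelah bound -/

section traces

variable {X : Type*} {ι : Type*} [Fintype ι]

open Classical in
/-- The labelings of the points `P` realized by members of `H`. -/
def traces (H : Set (Concept X)) (P : ι → X) : Finset (ι → Bool) :=
  Finset.univ.filter fun τ => ∃ h ∈ H, h ∘ P = τ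

theorem mem_traces {H : Set (Concept X)} {P : ι → X} {τ : ι → Bool} :
    τ ∈ traces H P ↔ ∃ h ∈ H, h ∘ P = τ := by
  classical
  simp [traces]

theorem comp_mem_traces {H : Set (Concept X)} {h : Concept X} (hh : h ∈ H) (P : ι → X) :
    h ∘ P ∈ traces H P :=
  mem_traces.2 ⟨h, hh, rfl⟩

/-- The number of positive labels. -/
def cnt (z : ι → Bool) : ℕ := (Finset.univ.filter fun i => z i = true).card

theorem prod_ite_eq_pow_cnt (a : ℝ≥0∞) (z : ι → Bool) :
    ∏ i, (if z i = true then a else 1) = a ^ cnt z := by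
  rw [Finset.prod_ite, Finset.prod_const, Finset.prod_const_one, mul_one, cnt]

/-- The pointwise exclusive or of two concepts. -/
def symmDiffClass (C D : Set (Concept X)) : Set (Concept X) :=
  {g | ∃ c ∈ C, ∃ d ∈ D, g = fun x => xor (c x) (d x)}

theorem card_traces_symmDiffClass (C D : Set (Concept X)) (P : ι → X) :
    (traces (symmDiffClass C D) P).card ≤ (traces C P).card * (traces D P).card := by
  classical
  rw [← Finset.card_product]
  refine (Finset.card_le_card ?_).trans
    (Finset.card_image_le (f := fun p : (ι → Bool) × (ι → Bool) => fun i => xor (p.1 i) (p.2 i)))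
  intro τ hτ
  obtain ⟨h, ⟨c, hc, d, hd, rfl⟩, rfl⟩ := mem_traces.1 hτ
  exact Finset.mem_image.2 ⟨(c ∘ P, d ∘ P),
    Finset.mem_product.2 ⟨comp_mem_traces hc P, comp_mem_traces hd P⟩, rfl⟩

theorem card_traces_singleton (c : Concept X) (P : ι → X) : (traces {c} P).card ≤ 1 := by
  refine Finset.card_le_one.2 fun a ha b hb => ?_
  obtain ⟨h, rfl, rfl⟩ := mem_traces.1 ha
  obtain ⟨h', rfl, rfl⟩ := mem_traces.1 hb
  rfl

/-- Sauer–Shelah for the family of index sets on which the traces are positive. Points of `P` may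
repeat, but an index set shattered by that family cannot contain two indices of the same point, so
`P` maps it injectively onto a set shattered by `C`. -/
theorem card_traces_le_sum_choose {C : Set (Concept X)} {d : ℕ}
    (hd : ∀ B : Finset X, IsShattered C B → B.card ≤ d) (P : ι → X) :
    (traces C P).card ≤ ∑ k ∈ Finset.Iic d, (Fintype.card ι).choose k := by
  classical
  set 𝒜 : Finset (Finset ι) := (traces C P).image fun τ => Finset.univ.filter fun i => τ i = true
    with h𝒜
  have hinj : Function.Injective
      fun τ : ι → Bool => (Finset.univ.filter fun i => τ i = true : Finset ι) := by
    intro τ τ' h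
    funext i
    have := congrArg (i ∈ ·) h
    simp only [Finset.mem_filter, Finset.mem_univ, true_and, eq_iff_iff] at this
    exact Bool.eq_iff_iff.2 this
  have hmem : ∀ {u}, u ∈ 𝒜 → ∃ c ∈ C, ∀ i, i ∈ u ↔ c (P i) = true := by
    intro u hu
    obtain ⟨τ, hτ, rfl⟩ := Finset.mem_image.1 hu
    obtain ⟨c, hc, rfl⟩ := mem_traces.1 hτ
    exact ⟨c, hc, fun i => by simp⟩
  have hvc : 𝒜.vcDim ≤ d := by
    refine Finset.sup_le fun s hs => ?_
    have hs := Finset.mem_shatterer.1 hs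
    have hPinj : Set.InjOn P s := by
      intro i hi j hj hij
      by_contra hne
      obtain ⟨u, hu, hsu⟩ := hs (Finset.singleton_subset_iff.2 hi)
      obtain ⟨c, -, hcu⟩ := hmem hu
      have h1 : i ∈ u := (Finset.mem_inter.1 (hsu.symm ▸ Finset.mem_singleton_self i)).2
      have h2 : j ∈ u := (hcu j).2 (hij ▸ (hcu i).1 h1)
      have h3 : j ∈ s ∩ u := Finset.mem_inter.2 ⟨hj, h2⟩
      rw [hsu, Finset.mem_singleton] at h3
      exact hne h3.symm
    rw [← Finset.card_image_of_injOn hPinj]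
    refine hd _ fun f => ?_
    obtain ⟨u, hu, hsu⟩ := hs (Finset.filter_subset (fun i => f (P i) = true) s)
    obtain ⟨c, hc, hcu⟩ := hmem hu
    refine ⟨c, hc, fun x hx => ?_⟩
    obtain ⟨i, hi, rfl⟩ := Finset.mem_image.1 hx
    rw [Bool.eq_iff_iff, ← hcu]
    have := congrArg (i ∈ ·) hsu
    simpa [hi] using this
  calc (traces C P).card = 𝒜.card := (Finset.card_image_of_injective _ hinj).symm
    _ ≤ _ := 𝒜.card_le_card_shatterer
    _ ≤ _ := 𝒜.card_shatterer_le_sum_vcDim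
    _ ≤ _ := Finset.sum_le_sum_of_subset (Finset.Iic_subset_Iic.2 hvc)

/-- Since x^d ≤ x^k for k ≤ d, multiplying the sum by x^d bounds it by (1 + x)^n. The parameter `x`
stays free so that the factor exp(x n) can be absorbed by a later exponential decay. -/
theorem sum_choose_le {x : ℝ} (hx : 0 < x) (hx1 : x ≤ 1) (n d : ℕ) :
    ((∑ k ∈ Finset.Iic d, n.choose k : ℕ) : ℝ) ≤ (1 / x) ^ d * Real.exp (x * n) := by
  have h1 : x ^ d * ((∑ k ∈ Finset.Iic d, n.choose k : ℕ) : ℝ) ≤ (1 + x) ^ n := by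
    rw [add_comm, add_pow]
    push_cast
    rw [Finset.mul_sum]
    calc ∑ k ∈ Finset.Iic d, x ^ d * (n.choose k : ℝ)
        = ∑ k ∈ Finset.Iic d with k ≤ n, x ^ d * (n.choose k : ℝ) := by
          rw [Finset.sum_filter_of_ne]
          intro k _ hk
          by_contra h
          exact hk (by simp [Nat.choose_eq_zero_of_lt (not_le.1 h)])
      _ ≤ ∑ k ∈ Finset.Iic d with k ≤ n, x ^ k * 1 ^ (n - k) * (n.choose k : ℝ) := by
          refine Finset.sum_le_sum fun k hk => ?_
          rw [one_pow, mul_one]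
          have hk : k ≤ d := Finset.mem_Iic.1 (Finset.mem_filter.1 hk).1
          exact mul_le_mul_of_nonneg_right (pow_le_pow_of_le_one hx.le hx1 hk) (Nat.cast_nonneg _)
      _ ≤ _ := by
          refine Finset.sum_le_sum_of_subset_of_nonneg ?_ fun k _ _ => by positivity
          intro k hk
          exact Finset.mem_range.2 (Nat.lt_succ_of_le (Finset.mem_filter.1 hk).2)
  have h2 : (1 + x) ^ n ≤ Real.exp (x * n) := by
    rw [mul_comm, Real.exp_nat_mul]
    have := Real.add_one_le_exp x
    gcongr
    linarith
  rw [one_div, inv_pow, inv_mul_eq_div, le_div_iff₀ (by positivity), mul_comm]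
  exact h1.trans h2

theorem card_traces_le {C : Set (Concept X)} {d : ℕ}
    (hd : ∀ B : Finset X, IsShattered C B → B.card ≤ d) {x : ℝ} (hx : 0 < x) (hx1 : x ≤ 1)
    (P : ι → X) :
    ((traces C P).card : ℝ) ≤ (1 / x) ^ d * Real.exp (x * Fintype.card ι) :=
  (Nat.cast_le.2 (card_traces_le_sum_choose hd P)).trans (sum_choose_le hx hx1 _ d)

end traces

/-! Uniform convergence -/

section uniformConvergence

variable {X : Type*} {ι : Type*} [Fintype ι]

/-- Exchange `inl i` and `inr i` for those `i` that are marked by `σ`. -/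
def swapPairs (σ : ι → Bool) : ι ⊕ ι ≃ ι ⊕ ι :=
  Function.Involutive.toPerm
    (Sum.elim (fun i => if σ i then Sum.inr i else Sum.inl i)
      (fun i => if σ i then Sum.inl i else Sum.inr i)) (by
    rintro (i | i) <;> cases h : σ i <;> simp [h])

/-- The exponential weight of a labeling of a double sample. -/
def pairWeight (τ : ι ⊕ ι → Bool) : ℝ≥0∞ :=
  2⁻¹ ^ cnt (τ ∘ Sum.inl) * (1 + 2⁻¹) ^ cnt (τ ∘ Sum.inr)

theorem pairWeight_eq_prod (τ : ι ⊕ ι → Bool) :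
    pairWeight τ = ∏ i, (if τ (Sum.inl i) = true then (2⁻¹ : ℝ≥0∞) else 1) *
      (if τ (Sum.inr i) = true then 1 + 2⁻¹ else 1) := by
  rw [Finset.prod_mul_distrib, pairWeight, ← prod_ite_eq_pow_cnt, ← prod_ite_eq_pow_cnt]
  rfl

/-- The two orders of a pair average to at most 1. A single positive label gives exactly (1/2 +
3/2)/2, which is why 1/2 on the first half is matched with 3/2 on the second. -/
theorem pair_factor_le (a b : Bool) :
    (if a = true then (2⁻¹ : ℝ≥0∞) else 1) * (if b = true then 1 + 2⁻¹ else 1) +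
      (if b = true then (2⁻¹ : ℝ≥0∞) else 1) * (if a = true then 1 + 2⁻¹ else 1) ≤ 2 := by
  have h : (2⁻¹ : ℝ≥0∞) + 2⁻¹ = 1 := ENNReal.inv_two_add_inv_two
  cases a <;> cases b
  · simp [one_add_one_eq_two]
  · simp only [Bool.false_eq_true, if_true, if_false, one_mul, mul_one]
    rw [add_assoc, h, one_add_one_eq_two]
  · simp only [Bool.false_eq_true, if_true, if_false, one_mul, mul_one]
    rw [add_left_comm, h, one_add_one_eq_two]
  · simp only [if_true]
    rw [← add_mul, h, one_mul]
    calc (1 : ℝ≥0∞) + 2⁻¹ ≤ 1 + (2⁻¹ + 2⁻¹) := by gcongr; exact le_self_add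
      _ = 2 := by rw [h, one_add_one_eq_two]

theorem sum_pairWeight_swapPairs_le [DecidableEq ι] (τ : ι ⊕ ι → Bool) :
    ∑ σ : ι → Bool, pairWeight (τ ∘ swapPairs σ) ≤ 2 ^ Fintype.card ι := by
  have h : ∀ σ : ι → Bool, pairWeight (τ ∘ swapPairs σ) =
      ∏ i, (if τ (if σ i then Sum.inr i else Sum.inl i) = true then (2⁻¹ : ℝ≥0∞) else 1) *
        (if τ (if σ i then Sum.inl i else Sum.inr i) = true then 1 + 2⁻¹ else 1) :=
    fun σ => pairWeight_eq_prod _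
  simp only [h]
  rw [← Fintype.prod_sum (fun i (b : Bool) =>
      (if τ (if b then Sum.inr i else Sum.inl i) = true then (2⁻¹ : ℝ≥0∞) else 1) *
        (if τ (if b then Sum.inl i else Sum.inr i) = true then 1 + 2⁻¹ else 1))]
  calc _ ≤ ∏ _i : ι, (2 : ℝ≥0∞) := by
        refine Finset.prod_le_prod' fun i _ => ?_
        rw [Fintype.sum_bool]
        simpa using pair_factor_le (τ (Sum.inr i)) (τ (Sum.inl i))
    _ = _ := by simp

theorem sum_traces_comp_equiv (H : Set (Concept X)) {κ : Type*} [Fintype κ] (P : κ → X)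
    (e : κ ≃ κ) (φ : (κ → Bool) → ℝ≥0∞) :
    ∑ τ ∈ traces H (P ∘ e), φ τ = ∑ τ ∈ traces H P, φ (τ ∘ e) := by
  refine Finset.sum_bij' (fun τ _ => τ ∘ e.symm) (fun τ _ => τ ∘ e) ?_ ?_ ?_ ?_ ?_
  · intro τ hτ
    obtain ⟨h, hh, rfl⟩ := mem_traces.1 hτ
    exact mem_traces.2 ⟨h, hh, by funext i; simp⟩
  · intro τ hτ
    obtain ⟨h, hh, rfl⟩ := mem_traces.1 hτ
    exact mem_traces.2 ⟨h, hh, rfl⟩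
  · intro τ _; funext i; simp
  · intro τ _; funext i; simp
  · intro τ _; congr 1; funext i; simp

/-- Symmetrization: the double sample is invariant under swapping pairs, so the weight may be
averaged over all swaps, after which each trace contributes at most 1. -/
theorem ev_sum_traces_pairWeight_le (μ : PMF X) (H : Set (Concept X)) {G : ℝ≥0∞}
    (hG : ∀ P : ι ⊕ ι → X, ((traces H P).card : ℝ≥0∞) ≤ G) :
    ev (iidOn (ι ⊕ ι) μ) (fun P => ∑ τ ∈ traces H P, pairWeight τ) ≤ G := by
  classical
  set E := ev (iidOn (ι ⊕ ι) μ) (fun P => ∑ τ ∈ traces H P, pairWeight τ) with hE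
  have h1 : ∀ σ : ι → Bool, E = ev (iidOn (ι ⊕ ι) μ)
      (fun P => ∑ τ ∈ traces H P, pairWeight (τ ∘ swapPairs σ)) := by
    intro σ
    rw [hE, ev_iidOn_equiv μ (swapPairs σ)]
    simp only [sum_traces_comp_equiv]
  have h2 : (2 : ℝ≥0∞) ^ Fintype.card ι * E ≤ 2 ^ Fintype.card ι * G := by
    calc (2 : ℝ≥0∞) ^ Fintype.card ι * E = ∑ _σ : ι → Bool, E := by simp
      _ = ∑ σ : ι → Bool, ev (iidOn (ι ⊕ ι) μ)
          (fun P => ∑ τ ∈ traces H P, pairWeight (τ ∘ swapPairs σ)) :=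
        Finset.sum_congr rfl fun σ _ => h1 σ
      _ = ev (iidOn (ι ⊕ ι) μ) (fun P => ∑ τ ∈ traces H P, ∑ σ : ι → Bool,
          pairWeight (τ ∘ swapPairs σ)) := by
        rw [← ev_finsetSum]
        congr 1
        funext P
        rw [Finset.sum_comm]
      _ ≤ _ := by
        refine ev_le _ fun P => ?_
        refine (Finset.sum_le_sum fun τ _ => sum_pairWeight_swapPairs_le τ).trans ?_
        rw [Finset.sum_const, nsmul_eq_mul, mul_comm]
        gcongr
        exact hG P
  exact (ENNReal.mul_le_mul_iff_right (by positivity) (by finiteness)).1 h2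

theorem ev_pow_cnt (μ : PMF X) (h : Concept X) :
    ev (iidOn ι μ) (fun S : ι → X => (1 + 2⁻¹) ^ cnt (h ∘ S)) =
      (1 + pr μ {x | h x = true} * 2⁻¹) ^ Fintype.card ι := by
  simp only [← prod_ite_eq_pow_cnt, Function.comp_apply]
  rw [ev_iidOn_prod μ fun _ x => if h x = true then (1 + 2⁻¹ : ℝ≥0∞) else 1, Finset.prod_const,
    Finset.card_univ]
  congr 1
  rw [pr_eq_ev, ← ev_mul_right]
  conv_rhs => rw [← ev_const μ 1]
  rw [← ev_add]
  congr 1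
  funext x
  cases hx : h x <;> simp [hx]

/-- With high probability every member of `H` that has few positive labels in the sample has a
small probability of being positive. -/
theorem uniform_convergence (μ : PMF X) (H : Set (Concept X)) {G : ℝ≥0∞}
    (hG : ∀ P : ι ⊕ ι → X, ((traces H P).card : ℝ≥0∞) ≤ G) (γ : ℝ≥0∞) (t : ℕ) :
    pr (iidOn ι μ) {S | ∃ h ∈ H, cnt (h ∘ S) ≤ t ∧ γ < pr μ {x | h x = true}} *
      (2⁻¹ ^ t * (1 + γ * 2⁻¹) ^ Fintype.card ι) ≤ G := by
  refine le_trans ?_ (ev_sum_traces_pairWeight_le μ H hG)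
  rw [ev_iidOn_sum, pr_eq_ev, ← ev_mul_right]
  refine ev_mono _ fun S => ?_
  by_cases hS : S ∈ {S | ∃ h ∈ H, cnt (h ∘ S) ≤ t ∧ γ < pr μ {x | h x = true}}
  · rw [Set.indicator_of_mem hS, Pi.one_apply, one_mul]
    obtain ⟨h, hh, hcnt, hγ⟩ := hS
    -- For a bad sample, one violating `h` already makes the conditional expectation over the second
    -- half large, so Markov's inequality replaces the usual lower tail for a ghost sample.
    calc (2⁻¹ : ℝ≥0∞) ^ t * (1 + γ * 2⁻¹) ^ Fintype.card ι
        ≤ 2⁻¹ ^ cnt (h ∘ S) * (1 + pr μ {x | h x = true} * 2⁻¹) ^ Fintype.card ι := by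
          gcongr ?_ * (1 + ?_ * _) ^ _
          exact pow_le_pow_of_le_one zero_le (by simp) hcnt
      _ = ev (iidOn ι μ) (fun S' => pairWeight (h ∘ Sum.elim S S')) := by
          rw [← ev_pow_cnt, ← ev_mul_left]
          rfl
      _ ≤ _ := ev_mono _ fun S' => Finset.single_le_sum (fun _ _ => zero_le)
          (comp_mem_traces hh (Sum.elim S S'))
  · rw [Set.indicator_of_notMem hS, zero_mul]
    exact zero_le

end uniformConvergence

/-! Sampling and differential privacy -/

/-- The values of `f` at any two vectors that differ in at most one entry are close. -/
def Stable {ι Z : Type*} (a δ : ℝ≥0∞) (f : (ι → Z) → ℝ≥0∞) : Prop :=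
  ∀ z z' : ι → Z, (∃ i, ∀ j, j ≠ i → z j = z' j) → f z ≤ a * f z' + δ

theorem Stable.ev {ι Z Ω : Type*} {a δ : ℝ≥0∞} {f : Ω → (ι → Z) → ℝ≥0∞} (p : PMF Ω)
    (h : ∀ ω, Stable a δ (f ω)) : Stable a δ fun z => ev p fun ω => f ω z := by
  intro z z' hz
  rw [← ev_mul_left, ← ev_const p δ, ← ev_add]
  exact ev_mono p fun ω => h ω z z' hz

theorem Stable.mono {ι Z : Type*} {a a' δ δ' : ℝ≥0∞} {f : (ι → Z) → ℝ≥0∞}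
    (h : Stable a δ f) (ha : a ≤ a') (hδ : δ ≤ δ') : Stable a' δ' f :=
  fun z z' hz => (h z z' hz).trans (by gcongr)

/-- The changed entry is drawn with probability 1/N. Its value is compared with the average over
`D'`, hence the excess `a / N` instead of a factor `a`. -/
theorem ev_uniform_slot {N Z : Type*} [Fintype N] [Nonempty N] {a δ : ℝ≥0∞} {f : Z → ℝ≥0∞}
    (hf : ∀ z z', f z ≤ a * f z' + δ) {D D' : N → Z} {i : N} (h : ∀ j, j ≠ i → D j = D' j) :
    ev (PMF.uniformOfFintype N) (fun j => f (D j)) ≤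
      (1 + a / Fintype.card N) * ev (PMF.uniformOfFintype N) (fun j => f (D' j)) +
        δ / Fintype.card N := by
  classical
  have h1 : f (D i) ≤ a * ev (PMF.uniformOfFintype N) (fun j => f (D' j)) + δ := by
    rw [← ev_mul_left, ← ev_const (PMF.uniformOfFintype N) δ, ← ev_add]
    exact le_ev _ fun j => hf _ _
  have h2 : ∑ j, f (D j) ≤
      a * ev (PMF.uniformOfFintype N) (fun j => f (D' j)) + δ + ∑ j, f (D' j) := by
    rw [← Finset.add_sum_erase _ _ (Finset.mem_univ i)]
    gcongr
    calc ∑ j ∈ Finset.univ.erase i, f (D j) = ∑ j ∈ Finset.univ.erase i, f (D' j) :=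
          Finset.sum_congr rfl fun j hj => by rw [h j (Finset.ne_of_mem_erase hj)]
      _ ≤ _ := Finset.sum_le_sum_of_subset (Finset.erase_subset _ _)
  set E := ev (PMF.uniformOfFintype N) (fun j => f (D' j)) with hE
  have hE' : E = (∑ j, f (D' j)) / Fintype.card N := ev_uniform _
  rw [ev_uniform]
  calc (∑ j, f (D j)) / Fintype.card N ≤ (a * E + δ + ∑ j, f (D' j)) / Fintype.card N := by
        gcongr
    _ = _ := by
        rw [ENNReal.add_div, ← hE', ENNReal.add_div]
        simp only [ENNReal.div_eq_inv_mul]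
        ring

/-- Hybrid argument: `D` is replaced by `D'` one draw at a time, because the changed entry may be
drawn repeatedly. Each draw costs a factor `1 + a / N`. -/
theorem iid_uniform_hybrid {N Z : Type*} [Fintype N] [Nonempty N] {a δ : ℝ≥0∞}
    {D D' : N → Z} {i : N} (h : ∀ j, j ≠ i → D j = D' j) :
    ∀ (n : ℕ) (F : (Fin n → Z) → ℝ≥0∞), Stable a δ F →
      ev (iid (PMF.uniformOfFintype N) n) (fun J => F (D ∘ J)) ≤
        (1 + a / Fintype.card N) ^ n * ev (iid (PMF.uniformOfFintype N) n) (fun J => F (D' ∘ J)) +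
          n * (1 + a / Fintype.card N) ^ n * (δ / Fintype.card N)
  | 0, F, _ => by
    have : ∀ J : Fin 0 → N, D ∘ J = D' ∘ J := fun J => Subsingleton.elim _ _
    simp [this]
  | n + 1, F, hF => by
    set U := PMF.uniformOfFintype N with hU
    set q := 1 + a / (Fintype.card N : ℝ≥0∞) with hq
    set b := δ / (Fintype.card N : ℝ≥0∞) with hb
    have hcons : ∀ (D : N → Z) (j : N) (J : Fin n → N),
        D ∘ (Fin.cons j J : Fin (n + 1) → N) = Fin.cons (D j) (D ∘ J) := by
      intro D j J
      funext k
      refine Fin.cases ?_ (fun l => ?_) k <;> simp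
    simp only [iid, ev_bind, ev_pure, hcons]
    have step1 : ∀ z : Z, ev (iid U n) (fun J => F (Fin.cons z (D ∘ J))) ≤
        q ^ n * ev (iid U n) (fun J => F (Fin.cons z (D' ∘ J))) + n * q ^ n * b := by
      intro z
      refine iid_uniform_hybrid h n (fun y => F (Fin.cons z y)) ?_
      rintro y y' ⟨k, hk⟩
      refine hF _ _ ⟨k.succ, fun j => ?_⟩
      refine Fin.cases (by simp) (fun l hl => ?_) j
      simp only [Fin.cons_succ]
      exact hk l fun e => hl (by rw [e])
    have step2 : ev U (fun j => ev (iid U n) (fun J => F (Fin.cons (D j) (D' ∘ J)))) ≤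
        q * ev U (fun j => ev (iid U n) (fun J => F (Fin.cons (D' j) (D' ∘ J)))) + b := by
      refine ev_uniform_slot (f := fun z => ev (iid U n) (fun J => F (Fin.cons z (D' ∘ J))))
        (a := a) (δ := δ) ?_ h
      intro z z'
      rw [← ev_mul_left, ← ev_const (iid U n) δ, ← ev_add]
      refine ev_mono _ fun J => ?_
      refine hF _ _ ⟨0, fun j => ?_⟩
      refine Fin.cases (fun h => absurd rfl h) (fun l _ => ?_) j
      simp
    have hq1 : 1 ≤ q := le_self_add
    calc _ ≤ ev U (fun j => q ^ n * ev (iid U n) (fun J => F (Fin.cons (D j) (D' ∘ J))) +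
          n * q ^ n * b) := ev_mono _ fun j => step1 (D j)
      _ = q ^ n * ev U (fun j => ev (iid U n) (fun J => F (Fin.cons (D j) (D' ∘ J)))) +
          n * q ^ n * b := by rw [ev_add, ev_mul_left, ev_const]
      _ ≤ q ^ n * (q * ev U (fun j => ev (iid U n) (fun J => F (Fin.cons (D' j) (D' ∘ J)))) + b) +
          n * q ^ n * b := by gcongr
      _ = q ^ (n + 1) * ev U (fun j => ev (iid U n) (fun J => F (Fin.cons (D' j) (D' ∘ J)))) +
          (n + 1) * q ^ n * b := by ring
      _ ≤ _ := by
          push_cast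
          gcongr
          exact Nat.le_succ n

/-! Amplification of privacy by subsampling -/

section amplify

variable {X : Type*} {n : ℕ}

/-- Choose, independently for every entry, one of `t` candidates and run `B` on the chosen
entries. -/
def amplify (B : Algorithm X n) (t : ℕ) [NeZero t] : Algorithm X (n * t) := fun D =>
  (iidOn (Fin n) (PMF.uniformOfFintype (Fin t))).bind fun r =>
    B fun j => D (finProdFinEquiv (j, r j))

/-- An input entry is a candidate for only one slot `j₀`. With the other choices fixed,
`ev_uniform_slot` applies to the choice at `j₀`. -/
theorem stable_amplify {B : Algorithm X n} {a δ : ℝ≥0∞} {F : Set (Concept X)}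
    (hB : Stable a δ fun D => pr (B D) F) (t : ℕ) [NeZero t] :
    Stable (1 + a / t) (δ / t) fun D => pr (amplify B t D) F := by
  rintro D D' ⟨i, hi⟩
  set U := PMF.uniformOfFintype (Fin t) with hU
  obtain ⟨⟨j₀, r₀⟩, rfl⟩ := finProdFinEquiv.surjective i
  simp only [amplify, pr_bind]
  rw [ev_iidOn_update U j₀, ev_iidOn_update U j₀ fun r =>
    pr (B fun j => D' (finProdFinEquiv (j, r j))) F, ← ev_mul_left,
    ← ev_const (iidOn (Fin n) U) (δ / t), ← ev_add]
  refine ev_mono _ fun r => ?_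
  have hupd : ∀ (D : Database X (n * t)) (s : Fin t),
      (fun j => D (finProdFinEquiv (j, Function.update r j₀ s j))) =
        Function.update (fun j => D (finProdFinEquiv (j, r j))) j₀
          (D (finProdFinEquiv (j₀, s))) := by
    intro D s
    funext j
    by_cases hj : j = j₀
    · subst hj; simp
    · simp [hj]
  have hbase : ∀ z, Function.update (fun j => D (finProdFinEquiv (j, r j))) j₀ z =
      Function.update (fun j => D' (finProdFinEquiv (j, r j))) j₀ z := by
    intro z
    funext j
    by_cases hj : j = j₀
    · subst hj; simp
    · simp only [Function.update_of_ne hj]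
      refine hi _ fun h => hj ?_
      exact congrArg Prod.fst (finProdFinEquiv.injective h)
  simp only [hupd, hbase]
  have := ev_uniform_slot (N := Fin t) (a := a) (δ := δ) (i := r₀)
    (f := fun z => pr (B (Function.update (fun j => D' (finProdFinEquiv (j, r j))) j₀ z)) F)
    (D := fun s => D (finProdFinEquiv (j₀, s))) (D' := fun s => D' (finProdFinEquiv (j₀, s)))
    (fun z z' => hB _ _ ⟨j₀, fun j hj => by simp [hj]⟩)
    (fun s hs => hi _ fun h => hs (congrArg Prod.snd (finProdFinEquiv.injective h)))
  simpa using this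

theorem pr_outputDist {B : Algorithm X n} (m : ℕ) (c : Concept X) (μ : PMF X)
    (E : Set (Concept X)) :
    pr (outputDist B m c μ) E = ev (iidOn (Fin n) μ) fun xs => pr (B (labelFirst c m xs)) E := by
  rw [outputDist, pr_bind, iid_eq_iidOn]

theorem pr_outputDist_amplify (B : Algorithm X n) (t : ℕ) [NeZero t] (m : ℕ) (c : Concept X)
    (μ : PMF X) (E : Set (Concept X)) :
    pr (outputDist (amplify B t) (m * t) c μ) E = pr (outputDist B m c μ) E := by
  simp only [pr_outputDist, amplify, pr_bind]
  rw [ev_comm]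
  refine Eq.trans ?_ (ev_const (iidOn (Fin n) (PMF.uniformOfFintype (Fin t))) _)
  refine congrArg _ (funext fun r => ?_)
  have hinj : Function.Injective fun j : Fin n => finProdFinEquiv (j, r j) := by
    intro j j' h
    exact congrArg Prod.fst (finProdFinEquiv.injective h)
  rw [← ev_iidOn_injective μ hinj]
  refine congrArg _ (funext fun xs => ?_)
  congr 2
  funext j
  -- Candidates of slot `j` occupy the block from `t * j` to `t * j + t - 1`, so the first `m * t`
  -- positions are exactly the candidates of the first `m` slots.
  have : (finProdFinEquiv (j, r j) : ℕ) < m * t ↔ (j : ℕ) < m := by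
    rw [finProdFinEquiv_apply_val, mul_comm m t]
    have hr := (r j).2
    dsimp only
    constructor
    · intro h
      by_contra hc
      have := Nat.mul_le_mul_left t (not_lt.1 hc)
      omega
    · intro h
      have := Nat.mul_le_mul_left t (Nat.succ_le_of_lt h)
      rw [Nat.succ_eq_add_one, mul_add] at this
      omega
  simp only [labelFirst, this, Function.comp_apply]

theorem isSSL_amplify {C : Set (Concept X)} {α β : ℝ} {m : ℕ} {B : Algorithm X n}
    (hB : IsSSL C α β m B) (t : ℕ) [NeZero t] : IsSSL C α β (m * t) (amplify B t) := by
  refine ⟨Nat.mul_le_mul_right t hB.1, fun c hc μ => ?_⟩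
  have := hB.2 c hc μ
  rwa [prob, ← pr, ← pr_outputDist_amplify B t m c μ, pr, ← prob] at this

end amplify

/-! Labeling fresh points with the exponential mechanism -/

section relabel

variable {X : Type*} {ι κ : Type*} [Fintype ι]

/-- The number of labeled examples on which `c` errs. -/
def errCount (D : ι → X × Bool) (c : Concept X) : ℕ := cnt fun i => xor (c (D i).1) (D i).2

theorem cnt_le_succ_of_eq_off {z z' : ι → Bool} {i : ι} (h : ∀ j, j ≠ i → z j = z' j) :
    cnt z ≤ cnt z' + 1 := by
  classical
  rw [cnt, cnt]
  refine (Finset.card_le_card ?_).trans (Finset.card_insert_le i _)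
  intro j hj
  by_cases hji : j = i
  · simp [hji]
  · simpa [hji, ← h j hji] using hj

variable (C : Set (Concept X))

/-- The weight of the labeling `z` of the points `T`: it decreases exponentially with the least
number of errors, on the labeled examples `D`, of a concept that induces `z`. -/
def weight (D : ι → X × Bool) (T : κ → X) (z : κ → Bool) : ℝ≥0∞ :=
  ⨆ c ∈ C, ⨆ _ : c ∘ T = z, 2⁻¹ ^ errCount D c

variable {C}

theorem le_weight {c : Concept X} (hc : c ∈ C) (D : ι → X × Bool) (T : κ → X) :
    2⁻¹ ^ errCount D c ≤ weight C D T (c ∘ T) :=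
  le_iSup₂_of_le c hc (le_iSup_of_le rfl le_rfl)

theorem weight_le {D : ι → X × Bool} {T : κ → X} {z : κ → Bool} {b : ℝ≥0∞}
    (h : ∀ c ∈ C, c ∘ T = z → 2⁻¹ ^ errCount D c ≤ b) : weight C D T z ≤ b :=
  iSup₂_le fun c hc => iSup_le fun hz => h c hc hz

theorem weight_le_one (D : ι → X × Bool) (T : κ → X) (z : κ → Bool) : weight C D T z ≤ 1 :=
  weight_le fun _ _ _ => pow_le_one₀ zero_le (by simp)

theorem weight_le_two_mul {D D' : ι → X × Bool} {i : ι} (h : ∀ j, j ≠ i → D j = D' j)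
    (T : κ → X) (z : κ → Bool) : weight C D T z ≤ 2 * weight C D' T z := by
  refine weight_le fun c hc hz => ?_
  subst hz
  refine le_trans ?_ (mul_le_mul_right (le_weight hc D' T) 2)
  have h1 : errCount D' c ≤ errCount D c + 1 :=
    cnt_le_succ_of_eq_off fun j hj => by rw [h j hj]
  calc (2⁻¹ : ℝ≥0∞) ^ errCount D c = 2 * 2⁻¹ ^ (errCount D c + 1) := by
        rw [pow_succ', ← mul_assoc, ENNReal.mul_inv_cancel (by simp) (by simp), one_mul]
    _ ≤ _ := by
        gcongr 2 * ?_
        exact pow_le_pow_of_le_one zero_le (by simp) h1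

/-- Flip the label at `i`. -/
def flipAt [DecidableEq κ] (i : κ) : (κ → Bool) ≃ (κ → Bool) :=
  Function.Involutive.toPerm (fun z => Function.update z i (!z i)) fun z => by simp

theorem flipAt_apply [DecidableEq κ] (i : κ) (z : κ → Bool) :
    flipAt i z = Function.update z i (!z i) := rfl

/-- A concept inducing `z` on `T` induces on `T'` either `z` or `z` flipped at `i`, with the same
errors on `D`. -/
theorem weight_le_add_flip [DecidableEq κ] (D : ι → X × Bool) {T T' : κ → X} {i : κ}
    (h : ∀ j, j ≠ i → T j = T' j) (z : κ → Bool) :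
    weight C D T z ≤ weight C D T' z + weight C D T' (flipAt i z) := by
  refine weight_le fun c hc hz => ?_
  have hoff : ∀ j, j ≠ i → c (T' j) = z j := fun j hj => by rw [← hz, Function.comp, h j hj]
  by_cases hi : c (T' i) = z i
  · have : c ∘ T' = z := by
      funext j
      by_cases hj : j = i
      · rw [hj]; exact hi
      · exact hoff j hj
    exact ((le_weight hc D T').trans_eq (by rw [this])).trans le_self_add
  · have : c ∘ T' = flipAt i z := by
      funext j
      rw [flipAt_apply]
      by_cases hj : j = i
      · subst hj
        rw [Function.update_self]
        exact Bool.eq_not.2 hi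
      · rw [Function.update_of_ne hj]
        exact hoff j hj
    exact ((le_weight hc D T').trans_eq (by rw [this])).trans le_add_self

variable [Fintype κ]

theorem sum_weight_ne_zero [DecidableEq κ] (hC : C.Nonempty) (D : ι → X × Bool) (T : κ → X) :
    ∑ z, weight C D T z ≠ 0 := by
  obtain ⟨c, hc⟩ := hC
  have h : 0 < weight C D T (c ∘ T) :=
    (ENNReal.pow_pos (by simp) _).trans_le (le_weight hc D T)
  exact (h.trans_le (Finset.single_le_sum (fun _ _ => zero_le) (Finset.mem_univ _))).ne'

theorem sum_weight_ne_top [DecidableEq κ] (D : ι → X × Bool) (T : κ → X) :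
    ∑ z, weight C D T z ≠ ∞ :=
  ENNReal.sum_ne_top.2 fun z _ => ((weight_le_one D T z).trans_lt ENNReal.one_lt_top).ne

open Classical in
/-- The exponential mechanism that labels the points `T` on the basis of the examples `D`. -/
def relabel (hC : C.Nonempty) (D : ι → X × Bool) (T : κ → X) : PMF (κ → Bool) :=
  PMF.normalize (weight C D T) (by rw [tsum_fintype]; exact sum_weight_ne_zero hC D T)
    (by rw [tsum_fintype]; exact sum_weight_ne_top D T)

theorem relabel_apply [DecidableEq κ] (hC : C.Nonempty) (D : ι → X × Bool) (T : κ → X)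
    (z : κ → Bool) :
    relabel hC D T z = weight C D T z * (∑ z, weight C D T z)⁻¹ := by
  rw [relabel, PMF.normalize_apply, tsum_fintype]

theorem ev_relabel [DecidableEq κ] (hC : C.Nonempty) (D : ι → X × Bool) (T : κ → X)
    (f : (κ → Bool) → ℝ≥0∞) :
    ev (relabel hC D T) f = (∑ z, weight C D T z)⁻¹ * ∑ z, weight C D T z * f z := by
  rw [ev_fintype, Finset.mul_sum]
  refine Finset.sum_congr rfl fun z _ => ?_
  rw [relabel_apply]
  ring

theorem inv_le_two_mul_inv {x y : ℝ≥0∞} (h : y ≤ 2 * x) : x⁻¹ ≤ 2 * y⁻¹ := by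
  rw [← ENNReal.inv_le_inv] at h
  calc x⁻¹ = 2 * (2 * x)⁻¹ := by
        rw [ENNReal.mul_inv (by simp) (by simp), ← mul_assoc,
          ENNReal.mul_inv_cancel (by simp) (by simp), one_mul]
    _ ≤ _ := by gcongr

/-- One example changes every error count by at most 1, hence each weight and the normalizing sum by
a factor 2 each. -/
theorem ev_relabel_examples_le (hC : C.Nonempty) {D D' : ι → X × Bool} {i : ι}
    (h : ∀ j, j ≠ i → D j = D' j) (T : κ → X) (f : (κ → Bool) → ℝ≥0∞) :
    ev (relabel hC D T) f ≤ 4 * ev (relabel hC D' T) f := by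
  classical
  have h' : ∀ j, j ≠ i → D' j = D j := fun j hj => (h j hj).symm
  have hZ : (∑ z, weight C D T z)⁻¹ ≤ 2 * (∑ z, weight C D' T z)⁻¹ := by
    refine inv_le_two_mul_inv ?_
    rw [Finset.mul_sum]
    exact Finset.sum_le_sum fun z _ => weight_le_two_mul h' T z
  rw [ev_relabel, ev_relabel]
  calc _ ≤ 2 * (∑ z, weight C D' T z)⁻¹ * ∑ z, 2 * weight C D' T z * f z := by
        gcongr with z
        exact weight_le_two_mul h T z
    _ = _ := by
        simp only [mul_assoc, ← Finset.mul_sum]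
        ring

/-- Numerator and normalizer each lose a factor 2 through `weight_le_add_flip`. The test functions
need to be compared only on labelings agreeing off `i`: the point and its label form one example of
the next learner, so changing both is still a one-entry change. -/
theorem ev_relabel_points_le (hC : C.Nonempty) (D : ι → X × Bool) {T T' : κ → X} {i : κ}
    (h : ∀ j, j ≠ i → T j = T' j) {a δ : ℝ≥0∞} {G G' : (κ → Bool) → ℝ≥0∞}
    (hG : ∀ z z' : κ → Bool, (∀ j, j ≠ i → z j = z' j) → G z ≤ a * G' z' + δ) :
    ev (relabel hC D T) G ≤ 4 * a * ev (relabel hC D T') G' + 4 * δ := by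
  classical
  have hflip : ∀ (W : (κ → Bool) → ℝ≥0∞), ∑ z, W (flipAt i z) = ∑ z, W z :=
    fun W => (flipAt i).sum_comp W
  have hZ : (∑ z, weight C D T z)⁻¹ ≤ 2 * (∑ z, weight C D T' z)⁻¹ := by
    refine inv_le_two_mul_inv ?_
    calc _ ≤ ∑ z, (weight C D T z + weight C D T (flipAt i z)) :=
          Finset.sum_le_sum fun z _ => weight_le_add_flip D (fun j hj => (h j hj).symm) z
      _ = _ := by rw [Finset.sum_add_distrib, hflip, two_mul]
  have hinv : ∀ z, flipAt i (flipAt i z) = z := fun z => by simp [flipAt_apply]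
  have hsum : ∑ z, weight C D T z * G z ≤
      ∑ z, weight C D T' z * (G z + G (flipAt i z)) := by
    calc _ ≤ ∑ z, (weight C D T' z + weight C D T' (flipAt i z)) * G z := by
          gcongr with z
          exact weight_le_add_flip D h z
      _ = ∑ z, weight C D T' z * G z + ∑ z, weight C D T' (flipAt i z) * G z := by
          rw [← Finset.sum_add_distrib]
          simp only [add_mul]
      _ = _ := by
          rw [← hflip fun z => weight C D T' (flipAt i z) * G z, ← Finset.sum_add_distrib]
          simp only [hinv, mul_add]
  have hGG : ∀ z, G z + G (flipAt i z) ≤ 2 * (a * G' z + δ) := by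
    intro z
    rw [two_mul]
    refine add_le_add (hG z z fun _ _ => rfl) (hG _ z fun j hj => ?_)
    rw [flipAt_apply, Function.update_of_ne hj]
  rw [ev_relabel]
  calc _ ≤ 2 * (∑ z, weight C D T' z)⁻¹ * ∑ z, weight C D T' z * (2 * (a * G' z + δ)) := by
        refine mul_le_mul' hZ (hsum.trans ?_)
        gcongr with z
        exact hGG z
    _ = 2 * ev (relabel hC D T') fun z => 2 * (a * G' z + δ) := by
        rw [ev_relabel, mul_assoc]
    _ = _ := by
        rw [ev_mul_left, ev_add, ev_mul_left, ev_const]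
        ring

/-- Label all points by `h`. -/
def labelAll (h : Concept X) (T : ι → X) : ι → X × Bool := fun i => (T i, h (T i))

theorem errCount_labelAll (c h : Concept X) (T : ι → X) :
    errCount (labelAll h T) c = cnt ((fun x => xor (c x) (h x)) ∘ T) := rfl

/-- The target has no errors, so the normalizer is at least 1. A bad labeling has weight at most
2^(-t), and labelings that are not traces have weight 0, so the union bound counts traces only. -/
theorem pr_relabel_bad_le (hC : C.Nonempty) {h : Concept X} (hh : h ∈ C) (S : ι → X)
    (T : κ → X) (t : ℕ) :
    pr (relabel hC (labelAll h S) T)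
      {z | ¬ ∃ h' ∈ C, h' ∘ T = z ∧ cnt ((fun x => xor (h' x) (h x)) ∘ S) ≤ t} ≤
        (traces C T).card * 2⁻¹ ^ t := by
  classical
  have hZ : (∑ z, weight C (labelAll h S) T z)⁻¹ ≤ 1 := by
    rw [ENNReal.inv_le_one]
    have h0 : errCount (labelAll h S) h = 0 := by simp [errCount_labelAll, cnt]
    calc (1 : ℝ≥0∞) = 2⁻¹ ^ errCount (labelAll h S) h := by rw [h0, pow_zero]
      _ ≤ weight C (labelAll h S) T (h ∘ T) := le_weight hh _ _
      _ ≤ _ := Finset.single_le_sum (fun _ _ => zero_le) (Finset.mem_univ _)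
  rw [pr_eq_ev, ev_relabel]
  refine (mul_le_of_le_one_left zero_le hZ).trans ?_
  rw [← nsmul_eq_mul, ← Finset.sum_const]
  calc _ ≤ ∑ z, if z ∈ traces C T then (2⁻¹ : ℝ≥0∞) ^ t else 0 := by
        refine Finset.sum_le_sum fun z _ => ?_
        by_cases hz : ∃ h' ∈ C, h' ∘ T = z ∧ cnt ((fun x => xor (h' x) (h x)) ∘ S) ≤ t
        · rw [Set.indicator_of_notMem (by simpa using hz), mul_zero]
          exact zero_le
        · rw [Set.indicator_of_mem (by simpa using hz), Pi.one_apply, mul_one]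
          refine weight_le fun c hc hcz => ?_
          rw [if_pos (hcz ▸ comp_mem_traces hc T)]
          refine pow_le_pow_of_le_one zero_le (by simp) ?_
          by_contra hlt
          exact hz ⟨c, hc, hcz, (not_le.1 hlt).le⟩
    _ = _ := by rw [← Finset.sum_filter]; simp

end relabel

/-! Learners whose labeled examples may be labeled by a concept that depends on them -/

section RobustlyLearnable

variable {X : Type*}

/-- The generalization error as an extended nonnegative real. -/
def err (μ : PMF X) (c h : Concept X) : ℝ≥0∞ := pr μ {x | h x ≠ c x}

theorem err_triangle (μ : PMF X) (c d h : Concept X) : err μ c h ≤ err μ c d + err μ d h := by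
  refine (pr_mono μ ?_).trans (pr_union μ _ _)
  intro x hx
  by_cases hd : d x = c x
  · exact Or.inr fun h => hx (h.trans hd)
  · exact Or.inl hd

theorem err_eq_xor (μ : PMF X) (c h : Concept X) :
    err μ c h = pr μ {x | (fun x => xor (h x) (c x)) x = true} := by
  rw [err]
  congr 1
  ext x
  simp

/-- There is a learner for `C` with labeled examples indexed by `ι` and unlabeled ones indexed by
`κ`, private with parameters `a, δ` in the former and `4 * a, 4 * δ` in the latter, whose error
exceeds `Γ` with probability at most `B`, even if the concept labeling the examples is chosen after
these have been drawn. -/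
def RobustlyLearnable (C : Set (Concept X)) (ι κ : Type) [Fintype ι] [Fintype κ]
    (Γ B a δ : ℝ≥0∞) : Prop :=
  ∃ P : (ι → X × Bool) → (κ → X) → PMF (Concept X),
    (∀ U F, Stable a δ fun D => pr (P D U) F) ∧
    (∀ D F, Stable (4 * a) (4 * δ) fun U => pr (P D U) F) ∧
    ∀ μ : PMF X, ev (iidOn ι μ) (fun T => ⨆ h ∈ C,
      ev (iidOn κ μ) fun U => pr (P (labelAll h T) U) {g | Γ < err μ h g}) ≤ B

theorem RobustlyLearnable.boost {C : Set (Concept X)} (hC : C.Nonempty) {ι κ₁ κ₂ : Type}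
    [Fintype ι] [Fintype κ₁] [Fintype κ₂] {Γ B a δ : ℝ≥0∞}
    (hP : RobustlyLearnable C κ₁ κ₂ Γ B a δ) (ha : 4 ≤ a) {γ b₁ b₂ : ℝ≥0∞} (t : ℕ)
    (hb₁ : ∀ μ : PMF X, pr (iidOn ι μ) {S | ∃ h ∈ symmDiffClass C C,
      cnt (h ∘ S) ≤ t ∧ γ < pr μ {x | h x = true}} ≤ b₁)
    (hb₂ : ∀ T : κ₁ → X, ((traces C T).card : ℝ≥0∞) * 2⁻¹ ^ t ≤ b₂) :
    RobustlyLearnable C ι (κ₁ ⊕ κ₂) (Γ + γ) (b₁ + (b₂ + B)) a δ := by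
  obtain ⟨P, hP₁, hP₂, hPu⟩ := hP
  refine ⟨fun D U => (relabel hC D (U ∘ Sum.inl)).bind fun z =>
    P (fun i => (U (Sum.inl i), z i)) (U ∘ Sum.inr), ?_, ?_, ?_⟩
  · rintro U F D D' ⟨i, hi⟩
    simp only [pr_bind]
    -- The examples influence the output only through the new labels, so the guarantee of `P` is not
    -- multiplied in.
    refine (ev_relabel_examples_le hC hi _ _).trans (le_add_right ?_)
    gcongr
  · rintro D F U U' ⟨i | k, hi⟩
    · simp only [pr_bind]
      have h2 : U ∘ Sum.inr = U' ∘ Sum.inr := by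
        funext k
        exact hi _ (by simp)
      rw [h2]
      refine ev_relabel_points_le hC D (i := i) (fun j hj => hi _ (by simpa using hj)) ?_
      intro z z' hz
      refine hP₁ _ F _ _ ⟨i, fun j hj => ?_⟩
      rw [hz j hj, hi (Sum.inl j) (by simpa using hj)]
    · simp only [pr_bind]
      have h1 : U ∘ Sum.inl = U' ∘ Sum.inl := by
        funext k
        exact hi _ (by simp)
      have h1' : ∀ i, U (Sum.inl i) = U' (Sum.inl i) := fun i => congrFun h1 i
      simp only [h1, h1']
      refine Stable.ev (relabel hC D (U' ∘ Sum.inl))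
        (fun z => hP₂ (fun i => (U' (Sum.inl i), z i)) F) _ _ ⟨k, fun j hj => ?_⟩
      exact hi _ (by simpa using hj)
  · intro μ
    set Bad : Set (ι → X) := {S | ∃ h ∈ symmDiffClass C C,
      cnt (h ∘ S) ≤ t ∧ γ < pr μ {x | h x = true}} with hBad
    set V : (κ₁ → X) → ℝ≥0∞ := fun T => ⨆ h ∈ C,
      ev (iidOn κ₂ μ) fun U => pr (P (labelAll h T) U) {g | Γ < err μ h g} with hV
    suffices h : ∀ S : ι → X, (⨆ h ∈ C, ev (iidOn (κ₁ ⊕ κ₂) μ) fun U =>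
        pr ((relabel hC (labelAll h S) (U ∘ Sum.inl)).bind fun z =>
          P (fun i => (U (Sum.inl i), z i)) (U ∘ Sum.inr)) {g | Γ + γ < err μ h g}) ≤
        Bad.indicator 1 S + (b₂ + B) by
      refine (ev_mono _ h).trans ?_
      rw [ev_add, ev_const, ← pr_eq_ev]
      gcongr
      exact hb₁ μ
    intro S
    refine iSup₂_le fun h hh => ?_
    by_cases hS : S ∈ Bad
    · rw [Set.indicator_of_mem hS]
      exact (ev_le _ fun U => pr_le_one _ _).trans le_self_add
    rw [Set.indicator_of_notMem hS, zero_add, ev_iidOn_sum]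
    have key : ∀ T : κ₁ → X, (ev (iidOn κ₂ μ) fun U =>
        pr ((relabel hC (labelAll h S) T).bind fun z =>
          P (fun i => (T i, z i)) U) {g | Γ + γ < err μ h g}) ≤ b₂ + V T := by
      intro T
      simp only [pr_bind]
      rw [ev_comm]
      set Z : Set (κ₁ → Bool) :=
        {z | ¬ ∃ h' ∈ C, h' ∘ T = z ∧ cnt ((fun x => xor (h' x) (h x)) ∘ S) ≤ t} with hZ
      calc _ ≤ ev (relabel hC (labelAll h S) T) (fun z => Z.indicator 1 z + V T) := by
            refine ev_mono _ fun z => ?_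
            by_cases hz : z ∈ Z
            · rw [Set.indicator_of_mem hz]
              exact (ev_le _ fun U => pr_le_one _ _).trans le_self_add
            rw [Set.indicator_of_notMem hz, zero_add]
            -- Now `P` sees `T` labeled by `h'`, which depends on `T`; the supremum in `V T` covers
            -- this choice, and closeness of `h'` to `h` adds `γ` to the error.
            obtain ⟨h', hh', rfl, hcnt⟩ := not_not.1 hz
            have hclose : err μ h h' ≤ γ := by
              by_contra hlt
              rw [err_eq_xor, not_le] at hlt
              exact hS ⟨_, ⟨h', hh', h, hh, rfl⟩, hcnt, hlt⟩
            refine le_trans (ev_mono _ fun U => pr_mono _ ?_) (le_iSup₂_of_le h' hh' le_rfl)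
            intro g hg
            by_contra hle
            have h1 := (err_triangle μ h h' g).trans (add_le_add hclose (not_lt.1 hle))
            rw [add_comm] at h1
            exact absurd hg (not_lt.2 h1)
        _ ≤ _ := by
            rw [ev_add, ev_const, ← pr_eq_ev]
            gcongr
            exact (pr_relabel_bad_le hC hh S T t).trans (hb₂ T)
    calc _ ≤ ev (iidOn κ₁ μ) (fun T => b₂ + V T) := ev_mono _ fun T => key T
      _ ≤ _ := by
          rw [ev_add, ev_const]
          gcongr
          exact hPu μ

end RobustlyLearnable

/-! Private learners as robust learners -/

section ofPSSL

variable {X : Type*}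

theorem stable_of_isDifferentiallyPrivate {n : ℕ} {ε δ : ℝ} {A : Algorithm X n} (hε : 0 ≤ ε)
    (hδ : 0 ≤ δ) (hA : IsDifferentiallyPrivate ε δ A) (F : Set (Concept X)) :
    Stable (ENNReal.ofReal (Real.exp ε)) (ENNReal.ofReal δ) fun D => pr (A D) F := by
  rintro D D' ⟨i, hi⟩
  by_cases h : D i = D' i
  · have : D = D' := funext fun j => if hj : j = i then hj ▸ h else hi j hj
    subst this
    refine le_add_right (le_mul_of_one_le_left zero_le ?_)
    rw [← ENNReal.ofReal_one]
    exact ENNReal.ofReal_le_ofReal (Real.one_le_exp hε)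
  · have hN : Neighboring D D' := ⟨i, h, fun j hj => by_contra fun hji => hj (hi j hji)⟩
    have := hA D D' hN F
    rw [prob, prob, ← ENNReal.le_ofReal_iff_toReal_le (pr_ne_top _ _) (by positivity),
      ENNReal.ofReal_add (by positivity) hδ, ENNReal.ofReal_mul (Real.exp_pos _).le,
      ENNReal.ofReal_toReal (pr_ne_top _ _)] at this
    exact this

theorem isDifferentiallyPrivate_of_stable {n : ℕ} {ε δ : ℝ} {A : Algorithm X n} (hδ : 0 ≤ δ)
    (hA : ∀ F, Stable (ENNReal.ofReal (Real.exp ε)) (ENNReal.ofReal δ) fun D => pr (A D) F) :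
    IsDifferentiallyPrivate ε δ A := by
  intro D D' hN F
  obtain ⟨i, -, hi⟩ := hN
  have := hA F D D' ⟨i, fun j hj => by_contra fun h => hj (hi j h)⟩
  rw [prob, prob, ← ENNReal.le_ofReal_iff_toReal_le (pr_ne_top _ _) (by positivity),
    ENNReal.ofReal_add (by positivity) hδ, ENNReal.ofReal_mul (Real.exp_pos _).le,
    ENNReal.ofReal_toReal (pr_ne_top _ _)]
  exact this

theorem prob_le_iff {Ω : Type*} (p : PMF Ω) (E : Set Ω) {β : ℝ} (hβ : 0 ≤ β) :
    prob p E ≤ β ↔ pr p E ≤ ENNReal.ofReal β :=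
  (ENNReal.le_ofReal_iff_toReal_le (pr_ne_top _ _) hβ).symm

theorem lt_genError_iff (μ : PMF X) (c h : Concept X) {α : ℝ} (hα : 0 ≤ α) :
    α < genError μ c h ↔ ENNReal.ofReal α < err μ c h := by
  rw [genError, ← not_le, prob_le_iff _ _ hα, not_le]
  rfl

theorem pr_uniform [Fintype X] [Nonempty X] (z : X → Bool) :
    pr (PMF.uniformOfFintype X) {x | z x = true} = cnt z / Fintype.card X := by
  rw [pr_eq_ev, ev_uniform, cnt, Finset.card_filter]
  push_cast
  congr 1
  refine Finset.sum_congr rfl fun x _ => ?_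
  by_cases h : z x = true <;> simp [h]

theorem cnt_comp_injective_le {ι κ : Type*} [Fintype ι] [Fintype κ] {e : ι → κ}
    (he : e.Injective) (z : κ → Bool) : cnt (z ∘ e) ≤ cnt z := by
  classical
  rw [cnt, ← Finset.card_image_of_injective _ he]
  refine Finset.card_le_card fun k hk => ?_
  obtain ⟨i, hi, rfl⟩ := Finset.mem_image.1 hk
  simpa using hi

variable {n N : ℕ}

/-- For fixed `J` and labels `z`, the output `g` depends only on the points read by `J`, so the
remaining points are a fresh sample for the class {g} xor C, which has no more traces than `C`. The
sum over `z` pays for labels chosen after the points. The number of unread points varies with `J`,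
hence the quantification over `κ` in `hb₀`. -/
theorem ev_sum_traces_resample_le {C : Set (Concept X)} (A : Algorithm X n) (μ : PMF X)
    {Γ b₀ b : ℝ≥0∞} (t : ℕ)
    (hb₀ : ∀ (κ : Type) [Fintype κ], N ≤ n + Fintype.card κ → Fintype.card κ ≤ N →
      ∀ g : Concept X, pr (iidOn κ μ) {S | ∃ h ∈ symmDiffClass {g} C,
        cnt (h ∘ S) ≤ t ∧ Γ < pr μ {x | h x = true}} ≤ b₀)
    (hb : ∀ P : Fin n → X, ((traces C P).card : ℝ≥0∞) * b₀ ≤ b) (J : Fin n → Fin N) :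
    ev (iidOn (Fin N) μ) (fun T => ∑ z ∈ traces C (T ∘ J),
      pr (A fun k => (T (J k), some (z k)))
        {g | ∃ h ∈ C, cnt ((fun x => xor (g x) (h x)) ∘ T) ≤ t ∧ Γ < err μ h g}) ≤ b := by
  classical
  set e := (Equiv.sumCompl (· ∈ Set.range J)) with he
  rw [ev_iidOn_equiv μ e.symm, ev_iidOn_sum]
  refine ev_le _ fun x => ?_
  set J' : Fin n → {j // j ∈ Set.range J} := fun k => ⟨J k, k, rfl⟩ with hJ'
  have hx : ∀ (y : {j // j ∉ Set.range J} → X) (k : Fin n),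
      (Sum.elim x y ∘ e.symm) (J k) = x (J' k) := by
    intro y k
    rw [Function.comp_apply, he, Equiv.sumCompl_symm_apply_of_pos ⟨k, rfl⟩]
    rfl
  have hx' : ∀ y : {j // j ∉ Set.range J} → X, (Sum.elim x y ∘ e.symm) ∘ J = x ∘ J' :=
    fun y => funext (hx y)
  have hcnt : ∀ (y : {j // j ∉ Set.range J} → X) (f : Concept X),
      cnt (f ∘ y) ≤ cnt (f ∘ (Sum.elim x y ∘ e.symm)) := by
    intro y f
    have : f ∘ y = (f ∘ (Sum.elim x y ∘ e.symm)) ∘ (e ∘ Sum.inr) := by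
      funext j
      simp
    rw [this]
    exact cnt_comp_injective_le (e.injective.comp Sum.inr_injective) _
  have hcard := Fintype.card_congr e
  rw [Fintype.card_sum, Fintype.card_fin] at hcard
  have hrange : Fintype.card {j // j ∈ Set.range J} ≤ n := by
    calc _ ≤ Fintype.card (Fin n) := Fintype.card_le_of_surjective J' (by
          rintro ⟨_, k, rfl⟩
          exact ⟨k, rfl⟩)
      _ = n := Fintype.card_fin n
  simp only [hx, hx']
  rw [ev_finsetSum]
  refine le_trans ?_ (hb (x ∘ J'))
  rw [← nsmul_eq_mul, ← Finset.sum_const]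
  refine Finset.sum_le_sum fun z _ => ?_
  simp only [pr_eq_ev (A _)]
  rw [ev_comm]
  refine ev_le _ fun g => ?_
  refine le_trans ?_ (hb₀ {j // j ∉ Set.range J} (by omega) (by omega) g)
  rw [pr_eq_ev]
  refine ev_mono _ fun y => ?_
  by_cases hg : g ∈ {g | ∃ h ∈ C, cnt ((fun x => xor (g x) (h x)) ∘ (Sum.elim x y ∘ e.symm)) ≤ t ∧
      Γ < err μ h g}
  · rw [Set.indicator_of_mem hg, Set.indicator_of_mem]
    · rfl
    · obtain ⟨h, hh, ht, hΓ⟩ := hg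
      rw [err_eq_xor] at hΓ
      exact ⟨_, ⟨g, rfl, h, hh, rfl⟩, (hcnt y _).trans ht, hΓ⟩
  · rw [Set.indicator_of_notMem hg]
    exact zero_le

variable [NeZero N]

/-- Run `A` on `n` examples drawn independently and uniformly from `N` given ones. -/
def resample (A : Algorithm X n) (D : Fin N → X × Bool) : PMF (Concept X) :=
  (iid (PMF.uniformOfFintype (Fin N)) n).bind fun J => A fun k => ((D (J k)).1, some (D (J k)).2)

theorem stable_resample {A : Algorithm X n} {a δ : ℝ≥0∞} {F : Set (Concept X)}
    (hA : Stable a δ fun D => pr (A D) F) :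
    Stable ((1 + a / N) ^ n) (n * (1 + a / N) ^ n * (δ / N))
      fun D : Fin N → X × Bool => pr (resample A D) F := by
  rintro D D' ⟨i, hi⟩
  have := iid_uniform_hybrid (a := a) (δ := δ) hi n
    (fun z => pr (A fun k => ((z k).1, some (z k).2)) F) (by
      rintro z z' ⟨k, hk⟩
      exact hA _ _ ⟨k, fun j hj => by rw [hk j hj]⟩)
  simp only [resample, pr_bind]
  rwa [Fintype.card_fin] at this

/-- Error under the empirical distribution of `T` is the number of disagreements divided by `N`. -/
theorem cnt_le_of_genError_le {T : Fin N → X} {α : ℝ} (hα : 0 ≤ α) {t : ℕ}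
    (ht : α * N < t + 1) {g h : Concept X}
    (hg : ¬ α < genError ((PMF.uniformOfFintype (Fin N)).map T) h g) :
    cnt ((fun x => xor (g x) (h x)) ∘ T) ≤ t := by
  have hN : (0 : ℝ) < N := Nat.cast_pos.2 (NeZero.pos N)
  rw [lt_genError_iff _ _ _ hα, not_lt, err_eq_xor, pr, PMF.toOuterMeasure_map_apply] at hg
  change pr _ {j | ((fun x => xor (g x) (h x)) ∘ T) j = true} ≤ _ at hg
  rw [pr_uniform, Fintype.card_fin, ENNReal.div_le_iff (by simpa using hN.ne') (by simp),
    ← ENNReal.ofReal_natCast N, ← ENNReal.ofReal_mul hα, ← ENNReal.ofReal_natCast,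
    ENNReal.ofReal_le_ofReal_iff (by positivity)] at hg
  exact Nat.lt_succ_iff.1 (by exact_mod_cast hg.trans_lt ht)

theorem RobustlyLearnable.of_isPSSL {C : Set (Concept X)} {A : Algorithm X n} {α β δ : ℝ}
    (hα : 0 ≤ α) (hβ : 0 ≤ β) (hδ : 0 ≤ δ) (hA : IsPSSL C α β 1 δ n n A) {Γ b₀ b a δ' : ℝ≥0∞}
    {t : ℕ} (ht : α * N < t + 1)
    (ha : (1 + ENNReal.ofReal (Real.exp 1) / N) ^ n ≤ a)
    (hδ' : n * (1 + ENNReal.ofReal (Real.exp 1) / N) ^ n * (ENNReal.ofReal δ / N) ≤ δ')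
    (hb₀ : ∀ (κ : Type) [Fintype κ], N ≤ n + Fintype.card κ → Fintype.card κ ≤ N →
      ∀ (μ : PMF X) (g : Concept X), pr (iidOn κ μ) {S | ∃ h ∈ symmDiffClass {g} C,
        cnt (h ∘ S) ≤ t ∧ Γ < pr μ {x | h x = true}} ≤ b₀)
    (hb : ∀ P : Fin n → X, ((traces C P).card : ℝ≥0∞) * b₀ ≤ b) :
    RobustlyLearnable C (Fin N) Empty Γ (ENNReal.ofReal β + b) a δ' := by
  refine ⟨fun D _ => resample A D, fun _ F =>
    (stable_resample (stable_of_isDifferentiallyPrivate zero_le_one hδ hA.2 F)).mono ha hδ',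
    fun D F U U' h => h.choose.elim, fun μ => ?_⟩
  set U := PMF.uniformOfFintype (Fin N) with hU
  simp only [ev_const]
  set Q : (Fin n → Fin N) → (Fin N → X) → ℝ≥0∞ := fun J T => ∑ z ∈ traces C (T ∘ J),
      pr (A fun k => (T (J k), some (z k)))
        {g | ∃ h ∈ C, cnt ((fun x => xor (g x) (h x)) ∘ T) ≤ t ∧ Γ < err μ h g} with hQ
  have key : ∀ T : Fin N → X, (⨆ h ∈ C, pr (resample A (labelAll h T)) {g | Γ < err μ h g}) ≤
      ENNReal.ofReal β + ev (iid U n) (fun J => Q J T) := by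
    intro T
    refine iSup₂_le fun h hh => ?_
    have hlab : ∀ J : Fin n → Fin N, (fun k => ((labelAll h T (J k)).1,
        some (labelAll h T (J k)).2)) = labelFirst h n (T ∘ J) := by
      intro J
      funext k
      simp [labelAll, labelFirst]
    calc pr (resample A (labelAll h T)) {g | Γ < err μ h g}
        = ev (iid U n) (fun J => pr (A (labelFirst h n (T ∘ J))) {g | Γ < err μ h g}) := by
          simp only [resample, pr_bind, hlab]
          rfl
      _ ≤ ev (iid U n) (fun J => pr (A (labelFirst h n (T ∘ J))) {g | α < genError (U.map T) h g} +
            Q J T) := by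
          refine ev_mono _ fun J => ?_
          -- Either the output is empirically poor, charged to `β`, or it fits `T` but generalizes
          -- badly, charged to `Q`.
          calc _ ≤ pr (A (labelFirst h n (T ∘ J))) ({g | α < genError (U.map T) h g} ∪
                {g | ∃ h ∈ C, cnt ((fun x => xor (g x) (h x)) ∘ T) ≤ t ∧ Γ < err μ h g}) := by
                refine pr_mono _ fun g hg => ?_
                by_cases hgT : α < genError (U.map T) h g
                · exact Or.inl hgT
                · exact Or.inr ⟨h, hh, cnt_le_of_genError_le hα ht hgT, hg⟩
            _ ≤ _ := (pr_union _ _ _).trans (by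
                gcongr
                have := Finset.single_le_sum (s := traces C (T ∘ J)) (f := fun z =>
                  pr (A fun k => (T (J k), some (z k))) {g | ∃ h ∈ C,
                    cnt ((fun x => xor (g x) (h x)) ∘ T) ≤ t ∧ Γ < err μ h g})
                  (fun _ _ => zero_le) (comp_mem_traces hh (T ∘ J))
                refine le_trans (le_of_eq ?_) this
                rw [← hlab]
                rfl)
      _ ≤ _ := by
          rw [ev_add]
          gcongr
          -- The learning guarantee is used for the empirical distribution of `T`; as it holds for
          -- every target, `h` may depend on `T`.
          have := hA.1.2 h hh (U.map T)
          rw [prob_le_iff _ _ hβ, outputDist, iid_map, pr_bind, ev_map] at this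
          exact this
  refine (ev_mono _ key).trans ?_
  rw [ev_add, ev_const, ev_comm]
  gcongr
  exact ev_le _ fun J => ev_sum_traces_resample_le A μ t (fun κ _ h1 h2 g => hb₀ κ h1 h2 μ g) hb J

end ofPSSL

/-! Quantitative bounds -/

section bounds

variable {X : Type*} {ι : Type*} [Fintype ι]

/-- Turns the growth (1 + γ/2)^n of `uniform_convergence` into exp(γ n / 3). -/
theorem exp_div_three_le {γ : ℝ} (h0 : 0 ≤ γ) (h1 : γ ≤ 1) : Real.exp (γ / 3) ≤ 1 + γ / 2 := by
  have := Real.exp_bound_div_one_sub_of_interval (x := γ / 3) (by linarith) (by linarith)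
  refine this.trans ?_
  rw [div_le_iff₀ (by linarith)]
  nlinarith

theorem uniform_convergence_real (μ : PMF X) (H : Set (Concept X)) {G γ b : ℝ}
    (hG : ∀ P : ι ⊕ ι → X, ((traces H P).card : ℝ) ≤ G) (h0 : 0 ≤ γ) (h1 : γ ≤ 1) (t : ℕ)
    (hb : G * 2 ^ t * Real.exp (-(γ * Fintype.card ι / 3)) ≤ b) :
    pr (iidOn ι μ) {S | ∃ h ∈ H, cnt (h ∘ S) ≤ t ∧ ENNReal.ofReal γ < pr μ {x | h x = true}} ≤
      ENNReal.ofReal b := by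
  have huc := uniform_convergence μ H (ι := ι) (G := ENNReal.ofReal G) (fun P => by
    rw [← ENNReal.ofReal_natCast]
    exact ENNReal.ofReal_le_ofReal (hG P)) (ENNReal.ofReal γ) t
  set p := pr (iidOn ι μ) {S | ∃ h ∈ H, cnt (h ∘ S) ≤ t ∧
    ENNReal.ofReal γ < pr μ {x | h x = true}} with hp
  have hfac : (2⁻¹ : ℝ≥0∞) ^ t * (1 + ENNReal.ofReal γ * 2⁻¹) ^ Fintype.card ι =
      ENNReal.ofReal ((2⁻¹) ^ t * (1 + γ * 2⁻¹) ^ Fintype.card ι) := by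
    have h2 : (2⁻¹ : ℝ≥0∞) = ENNReal.ofReal 2⁻¹ := by
      rw [ENNReal.ofReal_inv_of_pos (by norm_num)]
      norm_num
    rw [ENNReal.ofReal_mul (by positivity), ENNReal.ofReal_pow (by positivity),
      ENNReal.ofReal_pow (by positivity), ENNReal.ofReal_add (by positivity) (by positivity),
      ENNReal.ofReal_mul h0, h2, ENNReal.ofReal_one]
  -- The support of `μ` is nonempty, so some sample exists and `G` bounds a cardinality.
  have hG0 : 0 ≤ G := by
    by_cases hX : Nonempty (ι ⊕ ι → X)
    · exact (Nat.cast_nonneg _).trans (hG hX.some)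
    · exfalso
      obtain ⟨x, -⟩ := μ.support_nonempty
      exact hX ⟨fun _ => x⟩
  have hptop : p ≠ ∞ := pr_ne_top _ _
  rw [hfac, ← ENNReal.ofReal_toReal hptop,
    ← ENNReal.ofReal_mul ENNReal.toReal_nonneg, ENNReal.ofReal_le_ofReal_iff hG0] at huc
  rw [← ENNReal.ofReal_toReal hptop]
  refine ENNReal.ofReal_le_ofReal (le_trans ?_ hb)
  have hexp : Real.exp (γ * Fintype.card ι / 3) ≤ (1 + γ * 2⁻¹) ^ Fintype.card ι := by
    have : γ * Fintype.card ι / 3 = Fintype.card ι * (γ / 3) := by ring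
    rw [this, Real.exp_nat_mul]
    gcongr
    exact exp_div_three_le h0 h1
  rw [Real.exp_neg, ← div_eq_mul_inv, le_div_iff₀ (Real.exp_pos _)]
  have h2 : p.toReal * ((2⁻¹) ^ t * Real.exp (γ * Fintype.card ι / 3)) ≤ G := le_trans (by gcongr) huc
  calc p.toReal * Real.exp (γ * Fintype.card ι / 3)
      = p.toReal * ((2⁻¹) ^ t * Real.exp (γ * Fintype.card ι / 3)) * 2 ^ t := by
        rw [inv_pow]
        field_simp
    _ ≤ _ := by gcongr

theorem two_pow_le_exp {t : ℕ} {y : ℝ} (h : (t : ℝ) ≤ y) :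
    (2 : ℝ) ^ t ≤ Real.exp (7 / 10 * y) := by
  have h2 := Real.log_two_lt_d9
  calc (2 : ℝ) ^ t = Real.exp (t * Real.log 2) := by
        rw [Real.exp_nat_mul, Real.exp_log (by norm_num)]
    _ ≤ _ := by
        refine Real.exp_le_exp.2 ?_
        have : (0 : ℝ) ≤ t := Nat.cast_nonneg t
        nlinarith

theorem inv_two_pow_le_exp {t : ℕ} {y : ℝ} (h : y < t + 1) :
    (2⁻¹ : ℝ) ^ t ≤ 2 * Real.exp (-(69 / 100 * y)) := by
  have h2 := Real.log_two_gt_d9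
  calc (2⁻¹ : ℝ) ^ t = 2 * Real.exp (-((t + 1 : ℕ) * Real.log 2)) := by
        rw [Real.exp_neg, Real.exp_nat_mul, Real.exp_log (by norm_num), inv_pow, pow_succ,
          mul_inv]
        ring
    _ ≤ _ := by
        refine mul_le_mul_of_nonneg_left (Real.exp_le_exp.2 ?_) (by norm_num)
        push_cast
        nlinarith

variable {C : Set (Concept X)} {d : ℕ}

/-- Taking `x = γ / 64` in `card_traces_le` makes the linear term small against the decay of order γ
s in the later bounds. -/
theorem card_traces_le_exp (hd : ∀ B : Finset X, IsShattered C B → B.card ≤ d) {γ : ℝ}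
    (h0 : 0 < γ) (h1 : γ ≤ 1) {y : ℝ} (P : ι → X) (hy : (Fintype.card ι : ℝ) ≤ y) :
    ((traces C P).card : ℝ) ≤ Real.exp (d * Real.log (64 / γ) + γ * y / 64) := by
  refine (card_traces_le hd (x := γ / 64) (by positivity) (by linarith) P).trans ?_
  rw [Real.exp_add, Real.exp_nat_mul, Real.exp_log (by positivity), one_div_div]
  gcongr
  have := mul_le_mul_of_nonneg_left hy h0.le
  linarith

/-- One step of the chain: from `s` labeled examples to `2 * s` labeled ones. -/
theorem RobustlyLearnable.double (hC : C.Nonempty)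
    (hd : ∀ B : Finset X, IsShattered C B → B.card ≤ d) {s : ℕ} {κ : Type} [Fintype κ]
    {Γ B a δ : ℝ≥0∞} (hP : RobustlyLearnable C (Fin (2 * s)) κ Γ B a δ) (ha : 4 ≤ a) {γ b : ℝ}
    (h0 : 0 < γ) (h1 : γ ≤ 1)
    (hb : 4 * Real.exp (2 * (d * Real.log (64 / γ)) - γ * s / 12) ≤ b) :
    RobustlyLearnable C (Fin s) (Fin (2 * s) ⊕ κ) (Γ + ENNReal.ofReal γ)
      (ENNReal.ofReal b + B) a δ := by
  set L := d * Real.log (64 / γ) with hL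
  have hb0 : 0 ≤ b := le_trans (by positivity) hb
  have hγs : 0 ≤ γ * s := by positivity
  have hL0 : 0 ≤ L := by
    refine mul_nonneg (Nat.cast_nonneg d) (Real.log_nonneg ?_)
    rw [le_div_iff₀ h0]
    linarith
  -- The threshold balances two needs: 2^t must lose to exp(-γ s / 3) in the generalization bound,
  -- and 2^(-t) must beat the number of traces in the mechanism.
  set t := ⌊γ * s / 4⌋₊ with ht
  have ht1 : (t : ℝ) ≤ γ * s / 4 := Nat.floor_le (by positivity)
  have ht2 : γ * s / 4 < t + 1 := Nat.lt_floor_add_one _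
  have hsplit : ENNReal.ofReal b + B = ENNReal.ofReal (b / 2) + (ENNReal.ofReal (b / 2) + B) := by
    rw [← add_assoc, ← ENNReal.ofReal_add (by positivity) (by positivity), add_halves]
  rw [hsplit]
  refine hP.boost hC ha t (fun μ => ?_) (fun T => ?_)
  · have hG : ∀ P : Fin s ⊕ Fin s → X, ((traces C P).card : ℝ) ≤
        Real.exp (L + γ * (2 * s) / 64) := fun P =>
      card_traces_le_exp hd h0 h1 P (by simp [two_mul])
    refine uniform_convergence_real μ (symmDiffClass C C)
      (G := Real.exp (L + γ * (2 * s) / 64) * Real.exp (L + γ * (2 * s) / 64)) (fun P => ?_)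
      h0.le h1 t ?_
    · refine (Nat.cast_le.2 (card_traces_symmDiffClass C C P)).trans ?_
      push_cast
      gcongr <;> exact hG P
    · rw [Fintype.card_fin]
      calc _ ≤ Real.exp (L + γ * (2 * s) / 64) * Real.exp (L + γ * (2 * s) / 64) *
            Real.exp (7 / 10 * (γ * s / 4)) * Real.exp (-(γ * s / 3)) := by
            gcongr
            exact two_pow_le_exp ht1
        _ ≤ Real.exp (2 * L - γ * s / 12) := by
            simp only [← Real.exp_add]
            refine Real.exp_le_exp.2 ?_
            linarith
        _ ≤ _ := by
            have := Real.exp_pos (2 * L - γ * s / 12)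
            linarith
  · have h2 : ((traces C T).card : ℝ≥0∞) * 2⁻¹ ^ t =
        ENNReal.ofReal ((traces C T).card * 2⁻¹ ^ t) := by
      rw [ENNReal.ofReal_mul (Nat.cast_nonneg _), ENNReal.ofReal_natCast,
        ENNReal.ofReal_pow (by positivity), ENNReal.ofReal_inv_of_pos (by norm_num)]
      norm_num
    rw [h2]
    refine ENNReal.ofReal_le_ofReal ?_
    calc _ ≤ Real.exp (L + γ * (2 * s) / 64) * (2 * Real.exp (-(69 / 100 * (γ * s / 4)))) := by
          gcongr
          · exact card_traces_le_exp hd h0 h1 T (by simp)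
          · exact inv_two_pow_le_exp ht2
      _ = 2 * Real.exp (L + γ * (2 * s) / 64 + -(69 / 100 * (γ * s / 4))) := by
          rw [Real.exp_add (L + γ * (2 * s) / 64)]
          ring
      _ ≤ 2 * Real.exp (2 * L - γ * s / 12) := by
          gcongr
          linarith
      _ ≤ _ := by linarith

/-- The learner that resamples its `N` labeled examples. -/
theorem RobustlyLearnable.resample (hd : ∀ B : Finset X, IsShattered C B → B.card ≤ d)
    {n N : ℕ} {A : Algorithm X n} {α β δ : ℝ} (hα : 0 < α) (hα' : 12 * α ≤ 1) (hβ : 0 ≤ β)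
    (hδ : 0 ≤ δ) (hA : IsPSSL C α β 1 δ n n A) (hN : 0 < N) (hnN : 2 * n ≤ N)
    (hb : Real.exp (2 * (d * Real.log (64 / α)) - α * N / 12) ≤ β) :
    RobustlyLearnable C (Fin N) Empty (ENNReal.ofReal (12 * α)) (ENNReal.ofReal (2 * β)) 8
      (ENNReal.ofReal (4 * δ)) := by
  have : NeZero N := ⟨hN.ne'⟩
  have hN' : (0 : ℝ) < N := Nat.cast_pos.2 hN
  have hnN' : 2 * (n : ℝ) ≤ N := by exact_mod_cast hnN
  have hn0 : (0 : ℝ) ≤ n := Nat.cast_nonneg n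
  have hαN : 0 < α * N := by positivity
  set L := d * Real.log (64 / α) with hL
  have hfac : (1 + ENNReal.ofReal (Real.exp 1) / N) ^ n ≤ 8 := by
    rw [← ENNReal.ofReal_natCast N, ← ENNReal.ofReal_div_of_pos hN', ← ENNReal.ofReal_one,
      ← ENNReal.ofReal_add (by positivity) (by positivity), ← ENNReal.ofReal_pow (by positivity),
      ← ENNReal.ofReal_ofNat 8]
    refine ENNReal.ofReal_le_ofReal ?_
    have he := Real.exp_one_lt_d9
    calc (1 + Real.exp 1 / N) ^ n ≤ Real.exp (Real.exp 1 / N) ^ n := by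
          gcongr
          rw [add_comm]
          exact Real.add_one_le_exp _
      _ = Real.exp (n * (Real.exp 1 / N)) := (Real.exp_nat_mul _ _).symm
      _ ≤ Real.exp 2 := by
          refine Real.exp_le_exp.2 ?_
          rw [mul_div_assoc', div_le_iff₀ hN']
          nlinarith
      _ = Real.exp 1 * Real.exp 1 := by rw [← Real.exp_add]; norm_num
      -- The first privacy factor is at most e² < 8, since `N ≥ 2 * n` and e < 4.
      _ ≤ 8 := by nlinarith [Real.exp_pos 1]
  have hδ' : n * (1 + ENNReal.ofReal (Real.exp 1) / N) ^ n * (ENNReal.ofReal δ / N) ≤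
      ENNReal.ofReal (4 * δ) := by
    calc _ ≤ (n : ℝ≥0∞) * 8 * (ENNReal.ofReal δ / N) := by gcongr
      _ = ENNReal.ofReal (n * 8 * (δ / N)) := by
          rw [ENNReal.ofReal_mul (by positivity), ENNReal.ofReal_mul (by positivity),
            ENNReal.ofReal_div_of_pos hN', ENNReal.ofReal_natCast, ENNReal.ofReal_natCast,
            ENNReal.ofReal_ofNat]
      _ ≤ _ := by
          refine ENNReal.ofReal_le_ofReal ?_
          rw [mul_div_assoc', div_le_iff₀ hN']
          nlinarith
  rw [two_mul, ENNReal.ofReal_add hβ hβ]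
  set t := ⌊α * N⌋₊ with ht
  have ht1 : (t : ℝ) ≤ α * N := Nat.floor_le hαN.le
  refine RobustlyLearnable.of_isPSSL hα.le hβ hδ hA (t := t) (Nat.lt_floor_add_one _) hfac hδ'
    (b₀ := ENNReal.ofReal (Real.exp (L - α * N))) ?_ ?_
  · intro κ _ hκ1 hκ2 μ g
    have hκ1' : (N : ℝ) ≤ n + Fintype.card κ := by exact_mod_cast hκ1
    have hκ2' : (Fintype.card κ : ℝ) ≤ N := by exact_mod_cast hκ2
    refine uniform_convergence_real μ _ (G := Real.exp (L + α * (2 * N) / 64)) (fun P => ?_)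
      (by positivity) hα' t ?_
    · have := card_traces_symmDiffClass {g} C P
      have := this.trans (Nat.mul_le_mul_right _ (card_traces_singleton g P))
      rw [one_mul] at this
      refine (Nat.cast_le.2 this).trans (card_traces_le_exp hd hα (by linarith) P ?_)
      rw [Fintype.card_sum]
      push_cast
      linarith
    -- At least `N - n ≥ N / 2` points are unread, so error `12 * α` gives decay exp(-2αN), which
    -- beats 2^t with t ≤ αN.
    · calc _ ≤ Real.exp (L + α * (2 * N) / 64) * Real.exp (7 / 10 * (α * N)) *
            Real.exp (-(2 * (α * N))) := by
            gcongr
            · exact two_pow_le_exp ht1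
            · nlinarith
        _ ≤ _ := by
            simp only [← Real.exp_add]
            refine Real.exp_le_exp.2 ?_
            linarith
  · intro P
    rw [← ENNReal.ofReal_natCast, ← ENNReal.ofReal_mul (Nat.cast_nonneg _)]
    refine ENNReal.ofReal_le_ofReal (le_trans ?_ hb)
    calc _ ≤ Real.exp (L + α * N / 64) * Real.exp (L - α * N) := by
          gcongr
          refine card_traces_le_exp hd hα (by linarith) P ?_
          rw [Fintype.card_fin]
          linarith
      _ ≤ _ := by
          rw [← Real.exp_add]
          refine Real.exp_le_exp.2 ?_
          linarith

theorem RobustlyLearnable.mono {κ κ' : Type} [Fintype κ] [Fintype κ'] {Γ Γ' B B' a δ : ℝ≥0∞}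
    (h : RobustlyLearnable C κ κ' Γ B a δ) (hΓ : Γ ≤ Γ') (hB : B ≤ B') :
    RobustlyLearnable C κ κ' Γ' B' a δ := by
  obtain ⟨P, h1, h2, h3⟩ := h
  refine ⟨P, h1, h2, fun μ => le_trans (ev_mono _ fun T => ?_) ((h3 μ).trans hB)⟩
  gcongr with h hh
  exact ev_mono _ fun U => pr_mono _ fun g hg => hΓ.trans_lt hg

/-- The decay exponent is proportional to α s (3/2)^j ≥ α s (1 + j/2) by Bernoulli, while log(64/γ)
and the required log-failure grow only linearly in `j`. With the constant 48, dividing by 12 leaves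
4 d log(1/(αβ)) (1 + j/2), enough for both. -/
theorem chain_bound {α β : ℝ} (hα : 0 < α) (hα' : α < 1 / 16) (hβ : 0 < β) (hβ' : β < 1 / 16)
    (hd1 : 1 ≤ d) {s : ℕ} (hs : 48 * (d * Real.log (1 / (α * β))) ≤ α * s) (j : ℕ) :
    4 * Real.exp (2 * (d * Real.log (64 / (α * (3 / 4) ^ j))) -
      α * (3 / 4) ^ j * (2 ^ j * s : ℕ) / 12) ≤ β * (1 / 2) ^ (j + 1) := by
  have hlog2 := Real.log_two_lt_d9
  have hlog2' := Real.log_two_gt_d9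
  have hd1' : (1 : ℝ) ≤ d := by exact_mod_cast hd1
  have hj : (0 : ℝ) ≤ j := Nat.cast_nonneg j
  have hlog : Real.log (1 / (α * β)) = Real.log (1 / α) + Real.log (1 / β) := by
    rw [← Real.log_mul (by positivity) (by positivity)]
    congr 1
    field_simp
  have h16 : ∀ x : ℝ, 0 < x → x < 1 / 16 → 4 * Real.log 2 ≤ Real.log (1 / x) := by
    intro x hx hx'
    have : 4 * Real.log 2 = Real.log (2 ^ 4) := by rw [Real.log_pow]; norm_num
    rw [this]
    refine Real.log_le_log (by norm_num) ?_
    rw [le_div_iff₀ hx]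
    linarith
  have hla := h16 α hα hα'
  have hlb := h16 β hβ hβ'
  have h64 : Real.log (64 / (α * (3 / 4) ^ j)) ≤
      6 * Real.log 2 + Real.log (1 / α) + j * (1 / 3) := by
    have : 64 / (α * (3 / 4) ^ j) = 2 ^ 6 * (1 / α) * (4 / 3) ^ j := by
      rw [div_pow, div_pow]
      field_simp
      norm_num
    rw [this, Real.log_mul (by positivity) (by positivity),
      Real.log_mul (by positivity) (by positivity), Real.log_pow, Real.log_pow]
    have h43 := Real.log_le_sub_one_of_pos (x := 4 / 3) (by norm_num)
    push_cast
    nlinarith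
  have hpow : α * (3 / 4) ^ j * (2 ^ j * s : ℕ) = α * s * (3 / 2) ^ j := by
    push_cast
    have : (3 / 2 : ℝ) ^ j = (3 / 4) ^ j * 2 ^ j := by rw [← mul_pow]; norm_num
    rw [this]
    ring
  have hbern : 1 + (j : ℝ) / 2 ≤ (3 / 2) ^ j := by
    have := one_add_mul_le_pow (a := (1 / 2 : ℝ)) (by norm_num) j
    calc 1 + (j : ℝ) / 2 = 1 + j * (1 / 2) := by ring
      _ ≤ (1 + 1 / 2) ^ j := this
      _ = _ := by norm_num
  set a := Real.log (1 / α)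
  set b := Real.log (1 / β) with hb
  have hab : 0 ≤ a + b := by linarith
  have hbig : 48 * (d * (a + b)) * (1 + j / 2) ≤ α * s * (3 / 2) ^ j := by
    rw [hlog] at hs
    exact mul_le_mul hs hbern (by positivity) (by positivity)
  have hrhs : β * (1 / 2) ^ (j + 1) = Real.exp (-b - (j + 1) * Real.log 2) := by
    rw [sub_eq_add_neg, Real.exp_add, hb, one_div β, Real.log_inv, neg_neg, Real.exp_log hβ,
      Real.exp_neg]
    have : ((j : ℝ) + 1) * Real.log 2 = (j + 1 : ℕ) * Real.log 2 := by push_cast; ring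
    rw [this, Real.exp_nat_mul, Real.exp_log (by norm_num), one_div, inv_pow]
  have h4 : (4 : ℝ) = Real.exp (2 * Real.log 2) := by
    have := Real.exp_nat_mul (Real.log 2) 2
    rw [Real.exp_log (by norm_num)] at this
    push_cast at this
    rw [this]
    norm_num
  rw [hpow, hrhs]
  nth_rewrite 1 [h4]
  rw [← Real.exp_add]
  refine Real.exp_le_exp.2 ?_
  have h64d := mul_le_mul_of_nonneg_left h64 (by linarith : (0 : ℝ) ≤ d)
  have h5 : 4 * (d * (a + b)) * (1 + j / 2) ≤ α * s * (3 / 2) ^ j / 12 := by linarith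
  have h6 : b + (j + 3) * Real.log 2 ≤ d * (b + (j + 3) * Real.log 2) :=
    le_mul_of_one_le_left (add_nonneg (by linarith) (by positivity)) hd1'
  have h7 : 2 * (6 * Real.log 2 + a + j * (1 / 3)) + (b + (j + 3) * Real.log 2) ≤
      4 * (a + b) * (1 + j / 2) := by
    have hab5 : 5 * (j : ℝ) ≤ (a + b) * j := mul_le_mul_of_nonneg_right (by linarith) hj
    have hj2 : j * Real.log 2 ≤ j * 1 := mul_le_mul_of_nonneg_left (by linarith) hj
    linarith
  have h8 := mul_le_mul_of_nonneg_left h7 (by linarith : (0 : ℝ) ≤ d)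
  linarith

/-- The whole chain: the number of labeled examples is halved repeatedly. -/
theorem RobustlyLearnable.chain (hC : C.Nonempty)
    (hd : ∀ B : Finset X, IsShattered C B → B.card ≤ d) (hd1 : 1 ≤ d)
    {n : ℕ} {A : Algorithm X n} {α β δ : ℝ} (hα : 0 < α) (hα' : α < 1 / 16) (hβ : 0 < β)
    (hβ' : β < 1 / 16) (hδ : 0 ≤ δ) (hA : IsPSSL C α β 1 δ n n A) {s k : ℕ} (hs0 : 0 < s)
    (hs : 48 * (d * Real.log (1 / (α * β))) ≤ α * s) (hk : 2 * n ≤ 2 ^ k * s) :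
    ∀ i j : ℕ, j + i = k → ∃ (κ : Type) (_ : Fintype κ),
      Fintype.card κ + 2 * (2 ^ j * s) = 2 * (2 ^ k * s) ∧
      RobustlyLearnable C (Fin (2 ^ j * s)) κ (ENNReal.ofReal (12 * α + 4 * (α * (3 / 4) ^ j)))
        (ENNReal.ofReal (2 * β + β * (1 / 2) ^ j)) 8 (ENNReal.ofReal (4 * δ))
  | 0, j, hj => by
    obtain rfl : j = k := by simpa using hj
    refine ⟨Empty, inferInstance, by simp, ?_⟩
    refine (RobustlyLearnable.resample hd hα (by linarith) hβ.le hδ hA (by positivity) hk ?_).mono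
      (ENNReal.ofReal_le_ofReal (by linarith [show 0 ≤ 4 * (α * (3 / 4) ^ j) by positivity]))
      (ENNReal.ofReal_le_ofReal (by linarith [show 0 ≤ β * (1 / 2) ^ j by positivity]))
    have h0 := chain_bound hα hα' hβ hβ' hd1 hs 0
    have hss : (s : ℝ) ≤ (2 ^ j * s : ℕ) := by
      exact_mod_cast Nat.le_mul_of_pos_left s (by positivity)
    simp only [pow_zero, mul_one, one_mul, zero_add, pow_one] at h0
    have : Real.exp (2 * (d * Real.log (64 / α)) - α * (2 ^ j * s : ℕ) / 12) ≤
        Real.exp (2 * (d * Real.log (64 / α)) - α * s / 12) := by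
      refine Real.exp_le_exp.2 ?_
      have := mul_le_mul_of_nonneg_left hss hα.le
      linarith
    have hpos := Real.exp_pos (2 * (d * Real.log (64 / α)) - α * s / 12)
    linarith
  | i + 1, j, hj => by
    obtain ⟨κ, _, hcard, hκ⟩ := RobustlyLearnable.chain hC hd hd1 hα hα' hβ hβ' hδ hA hs0 hs hk
      i (j + 1) (by omega)
    have hpow : 2 ^ (j + 1) * s = 2 * (2 ^ j * s) := by ring
    rw [hpow] at hcard hκ
    have hγ1 : α * (3 / 4) ^ j ≤ 1 := by
      have : (3 / 4 : ℝ) ^ j ≤ 1 := pow_le_one₀ (by norm_num) (by norm_num)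
      nlinarith
    have := hκ.double hC hd (by norm_num) (γ := α * (3 / 4) ^ j) (by positivity) hγ1
      (chain_bound hα hα' hβ hβ' hd1 hs j)
    refine ⟨Fin (2 * (2 ^ j * s)) ⊕ κ, inferInstance, ?_, ?_⟩
    · rw [Fintype.card_sum, Fintype.card_fin]
      omega
    · rw [← ENNReal.ofReal_add (by positivity) (by positivity),
        ← ENNReal.ofReal_add (by positivity) (by positivity)] at this
      -- The geometric tails close up: 4(3/4)^(j+1) + (3/4)^j = 4(3/4)^j, and the failure terms
      -- satisfy the analogous identity.
      refine this.mono (ENNReal.ofReal_le_ofReal (le_of_eq ?_))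
        (ENNReal.ofReal_le_ofReal (le_of_eq ?_)) <;> ring

end bounds

/-! ### Degenerate cases, choice of parameters and the final learner -/

section assembly

variable {X : Type*} {C : Set (Concept X)}

theorem IsSSL.mono {α α' β β' : ℝ} {n m : ℕ} {A : Algorithm X n} (h : IsSSL C α β m A)
    (hα : α ≤ α') (hβ : β ≤ β') : IsSSL C α' β' m A := by
  refine ⟨h.1, fun c hc μ => le_trans ?_ ((h.2 c hc μ).trans hβ)⟩
  exact ENNReal.toReal_mono (pr_ne_top _ _) (pr_mono _ fun g hg => hα.trans_lt hg)

theorem isDifferentiallyPrivate_of_isEmpty {ε δ : ℝ} (A : Algorithm X 0) :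
    IsDifferentiallyPrivate ε δ A := by
  rintro D D' ⟨i, -⟩
  exact i.elim0

theorem isPSSL_pure_of_subsingleton (hC : C.Subsingleton) (α β ε δ : ℝ) (hα : 0 ≤ α)
    (hβ : 0 ≤ β) : ∃ A : Algorithm X 0, IsPSSL C α β ε δ 0 0 A := by
  rcases C.eq_empty_or_nonempty with rfl | ⟨c, hc⟩
  · exact ⟨fun _ => PMF.pure fun _ => true, ⟨le_rfl, fun c hc => absurd hc (by simp)⟩,
      isDifferentiallyPrivate_of_isEmpty _⟩
  · refine ⟨fun _ => PMF.pure c, ⟨le_rfl, fun c' hc' μ => ?_⟩,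
      isDifferentiallyPrivate_of_isEmpty _⟩
    obtain rfl := hC hc hc'
    rw [prob_le_iff _ _ hβ, pr_outputDist, ev_const, pr, PMF.toOuterMeasure_pure_apply, if_neg]
    · exact zero_le
    · rw [Set.mem_ofPred_eq, not_lt]
      simpa [genError, prob] using hα

theorem isPSSL_of_one_le (C : Set (Concept X)) {α β : ℝ} (ε δ : ℝ) (hβ : 0 ≤ β)
    (h : 1 ≤ α ∨ 1 ≤ β) : ∃ A : Algorithm X 0, IsPSSL C α β ε δ 0 0 A := by
  refine ⟨fun _ => PMF.pure fun _ => true, ⟨le_rfl, fun c _ μ => ?_⟩,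
    isDifferentiallyPrivate_of_isEmpty _⟩
  rcases h with h | h
  · have : {g | α < genError μ c g} = ∅ := by
      refine Set.eq_empty_of_forall_notMem fun g hg => ?_
      have h1 : genError μ c g ≤ 1 := by
        rw [genError, prob_le_iff _ _ zero_le_one, ENNReal.ofReal_one]
        exact pr_le_one _ _
      exact absurd (lt_of_lt_of_le hg h1) (not_lt.2 h)
    rw [this]
    simpa [prob] using hβ
  · refine le_trans ?_ h
    rw [prob_le_iff _ _ zero_le_one, ENNReal.ofReal_one]
    exact pr_le_one _ _

theorem exists_isPSSL_amplify {α β ε δ : ℝ} (hε : 0 < ε) (hε1 : ε ≤ 1) (hδ : 0 ≤ δ) {n m : ℕ}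
    {B : Algorithm X n} (hB : IsSSL C α β m B)
    (hS : ∀ F, Stable 32 (ENNReal.ofReal (16 * δ)) fun D => pr (B D) F) :
    ∃ t : ℕ, (t : ℝ) ≤ 33 / ε ∧ ∃ B' : Algorithm X (n * t), IsPSSL C α β ε δ (n * t) (m * t) B' := by
  -- With t ≥ 32/ε, the amplified factor satisfies 1 + 32/t ≤ 1 + ε ≤ e^ε, and 16δ/t ≤ δ because ε ≤
  -- 1.
  have ht0 : 0 < ⌈32 / ε⌉₊ := Nat.ceil_pos.2 (by positivity)
  have : NeZero ⌈32 / ε⌉₊ := ⟨ht0.ne'⟩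
  have ht : 32 / ε ≤ ⌈32 / ε⌉₊ := Nat.le_ceil _
  refine ⟨⌈32 / ε⌉₊, ?_, amplify B _, isSSL_amplify hB _,
    isDifferentiallyPrivate_of_stable hδ fun F => (stable_amplify (hS F) _).mono ?_ ?_⟩
  · have h1 : (⌈32 / ε⌉₊ : ℝ) < 32 / ε + 1 := Nat.ceil_lt_add_one (by positivity)
    have h2 : 1 ≤ 1 / ε := by rwa [le_div_iff₀ hε, one_mul]
    have h3 : 33 / ε = 32 / ε + 1 / ε := by ring
    linarith
  all_goals
    set t := ⌈32 / ε⌉₊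
    have ht0' : (0 : ℝ) < t := Nat.cast_pos.2 ht0
    rw [div_le_iff₀ hε] at ht
  · rw [← ENNReal.ofReal_natCast, ← ENNReal.ofReal_ofNat 32, ← ENNReal.ofReal_div_of_pos ht0',
      ← ENNReal.ofReal_one, ← ENNReal.ofReal_add zero_le_one (by positivity)]
    refine ENNReal.ofReal_le_ofReal ?_
    have h1 : 32 / (t : ℝ) ≤ ε := by
      rw [div_le_iff₀ ht0']
      linarith
    linarith [Real.add_one_le_exp ε]
  · rw [← ENNReal.ofReal_natCast, ← ENNReal.ofReal_div_of_pos ht0']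
    refine ENNReal.ofReal_le_ofReal ?_
    rw [div_le_iff₀ ht0']
    nlinarith

theorem RobustlyLearnable.exists_isSSL {m : ℕ} {κ : Type} [Fintype κ] {Γ B a δ : ℝ≥0∞}
    (h : RobustlyLearnable C (Fin m) κ Γ B a δ) :
    ∃ A : Algorithm X (m + Fintype.card κ),
      (∀ F, Stable (4 * a) (4 * δ) fun D => pr (A D) F) ∧
      ∀ c ∈ C, ∀ μ, pr (outputDist A m c μ) {g | Γ < err μ c g} ≤ B := by
  obtain ⟨P, h1, h2, h3⟩ := h
  set e := Fintype.equivFin κ with he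
  set E : Fin m ⊕ κ ≃ Fin (m + Fintype.card κ) :=
    (Equiv.sumCongr (Equiv.refl _) e).trans finSumFinEquiv with hE
  -- Privacy concerns arbitrary databases: a missing label among the first `m` entries is read as
  -- `false`, and labels elsewhere are discarded.
  refine ⟨fun D => P (fun i => ((D (E (Sum.inl i))).1, (D (E (Sum.inl i))).2.getD false))
    (fun k => (D (E (Sum.inr k))).1), ?_, ?_⟩
  · rintro F D D' ⟨x, hx⟩
    obtain ⟨i | k, rfl⟩ := E.surjective x
    · have hr : ∀ k, D (E (Sum.inr k)) = D' (E (Sum.inr k)) := fun k => hx _ (by simp)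
      simp only [hr]
      have h14 : (1 : ℝ≥0∞) ≤ 4 := by norm_num
      refine (h1 _ F).mono (le_mul_of_one_le_left zero_le h14)
        (le_mul_of_one_le_left zero_le h14) _ _ ⟨i, fun j hj => ?_⟩
      rw [hx (E (Sum.inl j)) (by simpa using hj)]
    · have hl : ∀ i, D (E (Sum.inl i)) = D' (E (Sum.inl i)) := fun i => hx _ (by simp)
      simp only [hl]
      refine h2 _ F _ _ ⟨k, fun j hj => ?_⟩
      rw [hx (E (Sum.inr j)) (by simpa using hj)]
  · intro c hc μ
    rw [pr_outputDist, ev_iidOn_equiv μ E.symm, ev_iidOn_sum]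
    refine le_trans (ev_mono _ fun T => ?_) (h3 μ)
    refine le_iSup₂_of_le c hc (le_of_eq (congrArg _ (funext fun U => ?_)))
    have hlt : ∀ i : Fin m, (E (Sum.inl i) : ℕ) < m := fun i => by simp [hE]
    simp [labelFirst, hlt]
    rfl

/-- The least `k` reaching `2 * n` overshoots by less than a factor 2; `s < n` handles `k = 0`. This
keeps the total sample linear in `n`. -/
theorem exists_pow_mul_mem {s n : ℕ} (hs : 0 < s) (hsn : s < n) :
    ∃ k, 2 * n ≤ 2 ^ k * s ∧ 2 ^ k * s < 4 * n := by
  classical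
  have hex : ∃ k, 2 * n ≤ 2 ^ k * s :=
    ⟨2 * n, (Nat.lt_two_pow_self).le.trans (Nat.le_mul_of_pos_right _ hs)⟩
  refine ⟨Nat.find hex, Nat.find_spec hex, ?_⟩
  rcases h : Nat.find hex with _ | k
  · omega
  · have := Nat.find_min hex (m := k) (by omega)
    rw [pow_succ, mul_right_comm]
    omega

theorem card_le_of_vcDim_eq {d : ℕ} (h : vcDim C = d) (B : Finset X) (hB : IsShattered C B) :
    B.card ≤ d := by
  have : (B.card : ℕ∞) ≤ vcDim C := le_iSup₂_of_le B hB le_rfl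
  rw [h] at this
  exact_mod_cast this

theorem one_le_vcDim (hC : ¬ C.Subsingleton) : 1 ≤ vcDim C := by
  rw [Set.not_subsingleton_iff] at hC
  obtain ⟨c, hc, c', hc', hne⟩ := hC
  obtain ⟨x, hx⟩ := Function.ne_iff.1 hne
  have : IsShattered C {x} := by
    intro f
    by_cases h : c x = f x
    · exact ⟨c, hc, by simpa using h⟩
    · refine ⟨c', hc', ?_⟩
      have : c' x = f x := by
        rw [Bool.eq_not.2 (Ne.symm hx), Bool.eq_not.2 h, Bool.not_not]
      simpa using this
  exact le_iSup₂_of_le {x} this (by simp)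

theorem exists_isPSSL_of_isPSSL {d : ℕ} (hC : C.Nonempty) (hd1 : 1 ≤ d)
    (hd : ∀ B : Finset X, IsShattered C B → B.card ≤ d) {α β ε δ : ℝ} {n : ℕ} (hα : 0 < α)
    (hα' : α < 1 / 16) (hβ : 0 < β) (hβ' : β < 1 / 16) (hε : 0 < ε) (hε1 : ε ≤ 1) (hδ : 0 ≤ δ)
    {A : Algorithm X n} (hA : IsPSSL C α β 1 δ n n A) {s : ℕ} (hs0 : 0 < s) (hsn : s < n)
    (hs : 48 * (d * Real.log (1 / (α * β))) ≤ α * s) :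
    ∃ n' m : ℕ, (n' : ℝ) ≤ 264 * (n / ε) ∧ (m : ℝ) ≤ 33 * (s / ε) ∧
      ∃ B : Algorithm X n', IsPSSL C (16 * α) (16 * β) ε δ n' m B := by
  obtain ⟨k, hk, hk'⟩ := exists_pow_mul_mem hs0 hsn
  obtain ⟨κ, _, hcard, hκ⟩ :=
    RobustlyLearnable.chain hC hd hd1 hα hα' hβ hβ' hδ hA hs0 hs hk k 0 (by omega)
  rw [pow_zero, one_mul] at hcard hκ
  obtain ⟨B, hBs, hBu⟩ := hκ.exists_isSSL
  have hB : IsSSL C (16 * α) (16 * β) s B := by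
    refine ⟨Nat.le_add_right _ _, fun c hc μ => ?_⟩
    rw [prob_le_iff _ _ (by positivity)]
    refine le_trans (pr_mono _ fun g hg => ?_)
      ((hBu c hc μ).trans (ENNReal.ofReal_le_ofReal ?_))
    · rw [Set.mem_ofPred_eq, lt_genError_iff _ _ _ (by positivity)] at hg
      refine lt_of_le_of_lt (ENNReal.ofReal_le_ofReal ?_) hg
      rw [pow_zero]
      linarith
    · rw [pow_zero]
      linarith
  obtain ⟨t, ht, B', hB'⟩ := exists_isPSSL_amplify hε hε1 hδ hB fun F =>
    (hBs F).mono (by norm_num) (by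
      rw [← ENNReal.ofReal_ofNat 4, ← ENNReal.ofReal_mul (by norm_num)]
      exact ENNReal.ofReal_le_ofReal (by linarith))
  refine ⟨_, _, ?_, ?_, B', hB'⟩
  -- The chain gives |κ| + 2s = 2 · 2^k s < 8n. The constant 264 is 8 · 33, with 33 from the number
  -- of candidates per entry.
  · have h8 : s + Fintype.card κ ≤ 8 * n := by omega
    have h8' : ((s + Fintype.card κ : ℕ) : ℝ) ≤ 8 * n := by exact_mod_cast h8
    rw [Nat.cast_mul]
    calc _ ≤ 8 * (n : ℝ) * (33 / ε) := mul_le_mul h8' ht (Nat.cast_nonneg _) (by positivity)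
      _ = _ := by ring
  · rw [Nat.cast_mul]
    calc _ ≤ (s : ℝ) * (33 / ε) := by gcongr
      _ = _ := by ring

/-- Fallback that only amplifies privacy and keeps all labels, for use when VC(C) is infinite or `n`
is already below the label budget. -/
theorem exists_isPSSL_labeled {α β ε δ : ℝ} {n : ℕ} (hα : 0 ≤ α) (hβ : 0 ≤ β) (hε : 0 < ε)
    (hε1 : ε ≤ 1) (hδ : 0 ≤ δ) {A : Algorithm X n} (hA : IsPSSL C α β 1 δ n n A) :
    ∃ m : ℕ, (m : ℝ) ≤ 33 * (n / ε) ∧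
      ∃ B : Algorithm X m, IsPSSL C (16 * α) (16 * β) ε δ m m B := by
  obtain ⟨t, ht, B', hB'⟩ := exists_isPSSL_amplify hε hε1 hδ
    (hA.1.mono (by linarith : α ≤ 16 * α) (by linarith : β ≤ 16 * β)) fun F =>
    (stable_of_isDifferentiallyPrivate zero_le_one hδ hA.2 F).mono (by
      rw [← ENNReal.ofReal_ofNat 32]
      exact ENNReal.ofReal_le_ofReal (by linarith [Real.exp_one_lt_d9]))
      (ENNReal.ofReal_le_ofReal (by linarith))
  refine ⟨_, ?_, B', hB'⟩
  rw [Nat.cast_mul]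
  calc _ ≤ (n : ℝ) * (33 / ε) := by gcongr
    _ = _ := by ring

theorem exists_isPSSL_vcDim {α β ε δ : ℝ} {n : ℕ} (hα : 0 < α)
    (hα' : α < 1 / 16) (hβ : 0 < β) (hβ' : β < 1 / 16) (hε : 0 < ε) (hε1 : ε ≤ 1) (hδ : 0 ≤ δ)
    {A : Algorithm X n} (hA : IsPSSL C α β 1 δ n n A) :
    ∃ n' m : ℕ, (n' : ℝ) ≤ 1617 * (n / ε) ∧
      (m : ℝ≥0∞) ≤
        ENNReal.ofReal (1617 * (Real.log (1 / (α * β)) / (α * ε))) * vcDim C ∧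
      ∃ B : Algorithm X n', IsPSSL C (16 * α) (16 * β) ε δ n' m B := by
  have hnε : (0 : ℝ) ≤ n / ε := by positivity
  have hlog : 1 ≤ Real.log (1 / (α * β)) := by
    rw [Real.le_log_iff_exp_le (by positivity), le_div_iff₀ (by positivity)]
    have := Real.exp_one_lt_d9
    have : α * β ≤ 1 / 16 * (1 / 16) := by gcongr
    nlinarith [Real.exp_pos 1, mul_pos hα hβ]
  -- Here the VC dimension can be 0, which forces `m = 0`; otherwise it is at least 1, so rounding
  -- `s` up is absorbed by replacing 48 with 49, and 1617 = 33 · 49.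
  by_cases hC : C.Subsingleton
  · obtain ⟨B, hB⟩ :=
      isPSSL_pure_of_subsingleton hC (16 * α) (16 * β) ε δ (by positivity) (by positivity)
    exact ⟨0, 0, by simpa using by positivity, by simp, B, hB⟩
  have hne : C.Nonempty := by
    by_contra h
    exact hC (Set.not_nonempty_iff_eq_empty.1 h ▸ Set.subsingleton_empty)
  have h1 := one_le_vcDim hC
  obtain ⟨m, hm, Bm, hBm⟩ := exists_isPSSL_labeled hα.le hβ.le hε hε1 hδ hA
  rcases h : vcDim C with _ | d
  · refine ⟨m, m, by linarith, ?_, Bm, hBm⟩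
    have : ENNReal.ofReal (1617 * (Real.log (1 / (α * β)) / (α * ε))) * ((⊤ : ℕ∞) : ℝ≥0∞) = ⊤ := by
      rw [ENat.toENNReal_top, ENNReal.mul_top]
      have : 0 < 1617 * (Real.log (1 / (α * β)) / (α * ε)) := by positivity
      simpa using this
    exact le_top.trans_eq this.symm
  · change vcDim C = (d : ℕ∞) at h
    have hd1 : 1 ≤ d := by
      rw [h] at h1
      exact_mod_cast h1
    have hd := card_le_of_vcDim_eq h
    have hd1' : (1 : ℝ) ≤ d := by exact_mod_cast hd1
    set L := Real.log (1 / (α * β)) with hL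
    set s := ⌈48 * (d * L) / α⌉₊ with hs
    have hs0 : 0 < s := Nat.ceil_pos.2 (by positivity)
    have hs1 : 48 * (d * L) ≤ α * s := by
      rw [mul_comm α, ← div_le_iff₀ hα]
      exact Nat.le_ceil _
    have hs2 : (s : ℝ) ≤ 49 * (d * L) / α := by
      have h2 : (s : ℝ) < 48 * (d * L) / α + 1 := Nat.ceil_lt_add_one (by positivity)
      have h3 : 1 ≤ d * L / α := by
        rw [le_div_iff₀ hα]
        nlinarith
      have h4 : 49 * (d * L) / α = 48 * (d * L) / α + d * L / α := by ring
      linarith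
    have hbound : ∀ m' : ℕ, (m' : ℝ) ≤ 33 * (s / ε) →
        (m' : ℝ≥0∞) ≤ ENNReal.ofReal (1617 * (L / (α * ε))) * ((d : ℕ∞) : ℝ≥0∞) := by
      intro m' hm'
      rw [ENat.toENNReal_coe, ← ENNReal.ofReal_natCast, ← ENNReal.ofReal_natCast,
        ← ENNReal.ofReal_mul (by positivity)]
      refine ENNReal.ofReal_le_ofReal (hm'.trans ?_)
      calc 33 * (s / ε) ≤ 33 * (49 * (d * L) / α / ε) := by gcongr
        _ = _ := by field_simp; ring
    by_cases hsn : s < n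
    · obtain ⟨n', m', hn', hm', B, hB⟩ := exists_isPSSL_of_isPSSL hne hd1 hd hα hα' hβ hβ' hε hε1
        hδ hA hs0 hsn hs1
      exact ⟨n', m', by linarith, hbound m' hm', B, hB⟩
    · refine ⟨m, m, by linarith, hbound m (hm.trans ?_), Bm, hBm⟩
      have : (n : ℝ) ≤ s := by exact_mod_cast not_lt.1 hsn
      gcongr

end assembly

end

end PrivateLearning


theorem mainTheorem2 :
    ∃ lam K : ℝ, 0 < lam ∧ 0 < K ∧
      ∀ (X : Type*) (C : Set (PrivateLearning.Concept X)) (α β ε δ : ℝ) (n : ℕ),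
        0 < α → α < 1 → 0 < β → β < 1 → 0 < ε → ε ≤ 1 → 0 ≤ δ →
        (∃ A : PrivateLearning.Algorithm X n, PrivateLearning.IsPSSL C α β 1 δ n n A) →
        ∃ n' m : ℕ,
          (n' : ℝ) ≤ K * (n / ε) ∧
          (m : ℝ≥0∞) ≤
            ENNReal.ofReal (K * (Real.log (1 / (α * β)) / (α * ε))) * PrivateLearning.vcDim C ∧
          ∃ B : PrivateLearning.Algorithm X n',
            PrivateLearning.IsPSSL C (lam * α) (lam * β) ε δ n' m B := by
  refine ⟨16, 1617, by norm_num, by norm_num, ?_⟩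
  rintro X C α β ε δ n hα - hβ - hε hε1 hδ ⟨A, hA⟩
  -- If either scaled parameter reaches 1, the requirement is vacuous and no sample is needed.
  by_cases h : 1 ≤ 16 * α ∨ 1 ≤ 16 * β
  · obtain ⟨B, hB⟩ := PrivateLearning.isPSSL_of_one_le C ε δ (by positivity) h
    exact ⟨0, 0, by simpa using by positivity, by simp, B, hB⟩
  · rw [not_or, not_le, not_le] at h
    exact PrivateLearning.exists_isPSSL_vcDim hα (by linarith) hβ (by linarith) hε hε1 hδ hA
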